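/- Let $0<\beta<1/2$, $0\le\theta\le 1$, and let $m\ge 0$ be an integer. For a function $w$ on $(0,1)$ put $${}_0I_x^\beta w(x)=\frac1{\Gamma(\beta)}\int_0^x\frac{w(s)}{(x-s)^{1-\beta}}\,ds,\qquad {}_xI_1^\beta w(x)=\frac1{\Gamma(\beta)}\int_x^1\frac{w(s)}{(s-x)^{1-\beta}}\,ds,$$ $$I^\beta_\theta w=\theta\,{}_0I_x^\beta w+(1-\theta)\,{}_xI_1^\beta w .$$ Write ${}_0I_1^\beta w$ for the value of ${}_0I_x^\beta w$ at $x=1$ and also, with left superscript $r$, ${}^r_0I_1^\beta w$ for the value of ${}_xI_1^\beta w$ at $x=0$. For $\mu>0$ let $H^\mu_0(0,1)$ be the completion of $C_0^\infty(0,1)$ in the norm of $H^\mu(\mathbb R)$; let $D$ denote the weak derivative on $(0,1)$. Let $K\in C^{m+1}[0,1]$ with $0<K_m\le K(x)\le K_M<\infty$ on $(0,1)$, and set $w_l(x)=\bigl(\int_0^1\frac{ds}{K(s)}\bigr)^{-1}\int_x^1\frac{ds}{K(s)}$. Let $u_l\in H^{1-\beta}_0(0,1)$ be the solution of $$I^\beta_\theta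 u_l-(1-\theta)\bigl({}^r_0I_1^\beta u_l\bigr)(1-x)-\theta\bigl({}_0I_1^\beta u_l\bigr)x=w_l-(1-x),\qquad 0\le x\le 1,$$ and assume that $$1+\theta\,{}_0I_1^\beta u_l-(1-\theta)\,{}^r_0I_1^\beta u_l\ne 0 .$$ Then there is a constant $C>0$, depending only on $\beta,\theta,m$ and $K$, such that the following holds for every $f\in H^m(0,1)$ and every weak solution $u$ of $-D(K\,D I^\beta_\theta u)=f$, $u(0)=u(1)=0$, that is, every $u\in H^{1-\beta}_0(0,1)$ with $$\int_0^1 K\,(D I^\beta_\theta u)\,(Dv)\,dx=\int_0^1 f\,v\,dx\qquad\text{for all } v\in H^1_0(0,1).$$ One has $I^\beta_\theta u\in H^{m+2}(0,1)$ and $$\|I^\beta_\theta u\|_{H^{m+2}(0,1)}\le C\bigl(\|K\|_{C^{m+1}[0,1]}+\|f\|_{H^m(0,1)}\bigr).$$ In particular, the derivative $D^{m+2}I^\beta_\theta u$ exists as a weak derivative in $L^2(0,1)$, and its $L^2(0,1)$ norm is bounded by the same right-hand side. -/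

import Mathlib

open MeasureTheory Set Filter Topology
open scoped ContDiff FourierTransform

noncomputable section

namespace FracDiff

/-! Real functions on `(0,1)` are represented by total functions `ℝ → ℝ`; only their values
in `(0,1)` matter (in `[0,1]` for the coefficient `K`), and up to null sets for elements of
Lebesgue and Sobolev spaces. -/

/-- Lebesgue measure on `(0,1)`. -/
def vol01 : Measure ℝ := volume.restrict (Ioo 0 1)

/-- `φ ∈ C₀^∞(0,1)` (extended by zero to `ℝ`). -/
def IsTest (φ : ℝ → ℝ) : Prop :=
  ContDiff ℝ ∞ φ ∧ HasCompactSupport φ ∧ tsupport φ ⊆ Ioo 0 1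

/-- `g` is the weak derivative of order `k` of `w` on `(0,1)`. -/
def HasWeakDeriv (k : ℕ) (w g : ℝ → ℝ) : Prop :=
  LocallyIntegrableOn w (Ioo 0 1) ∧ LocallyIntegrableOn g (Ioo 0 1) ∧
    ∀ φ : ℝ → ℝ, IsTest φ →
      ∫ x in Ioo (0 : ℝ) 1, w x * iteratedDeriv k φ x =
        (-1) ^ k * ∫ x in Ioo (0 : ℝ) 1, g x * φ x

open Classical in
/-- The weak derivative `D^k w` on `(0,1)` (unique up to null sets; `0` if there is none). -/
def weakDeriv (k : ℕ) (w : ℝ → ℝ) : ℝ → ℝ :=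
  if h : ∃ g, HasWeakDeriv k w g then h.choose else 0

/-- `‖w‖_{L²(0,1)}` for `w ∈ L²(0,1)`. -/
def l2Norm (w : ℝ → ℝ) : ℝ := √(∫ x in Ioo (0 : ℝ) 1, (w x) ^ 2)

/-- `w ∈ H^m(0,1)`: all weak derivatives of order at most `m` exist and are in `L²(0,1)`. -/
def MemH (m : ℕ) (w : ℝ → ℝ) : Prop :=
  ∀ k ≤ m, ∃ g, HasWeakDeriv k w g ∧ MemLp g 2 vol01

/-- `‖w‖_{H^m(0,1)}` for `w ∈ H^m(0,1)`. -/
def hNorm (m : ℕ) (w : ℝ → ℝ) : ℝ :=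
  √(∑ k ∈ Finset.range (m + 1), (l2Norm (weakDeriv k w)) ^ 2)

/-- `‖K‖_{C^n[0,1]}` for `K ∈ C^n[0,1]`. -/
def cNorm (n : ℕ) (K : ℝ → ℝ) : ℝ :=
  ∑ k ∈ Finset.range (n + 1),
    ⨆ x : Icc (0 : ℝ) 1, |iteratedDerivWithin k K (Icc 0 1) x|

/-- `‖φ‖_{H^μ(ℝ)}` for `φ ∈ C₀^∞(ℝ)`, with `ω = 2πξ` as the frequency variable. -/
def fracNorm (μ : ℝ) (φ : ℝ → ℝ) : ℝ :=
  √((∫ x : ℝ, (φ x) ^ 2) +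
    ∫ ξ : ℝ, ((2 * Real.pi * |ξ|) ^ μ * ‖𝓕 (fun x : ℝ => (φ x : ℂ)) ξ‖) ^ 2)

/-- `w ∈ H^μ_0(0,1)`, the completion of `C₀^∞(0,1)` in the norm of `H^μ(ℝ)`, realised inside
`L²(0,1)`: `w` is the `L²`-limit of a sequence of test functions that is Cauchy in the norm of
`H^μ(ℝ)`. -/
def MemH0 (μ : ℝ) (w : ℝ → ℝ) : Prop :=
  MemLp w 2 vol01 ∧ ∃ φ : ℕ → ℝ → ℝ, (∀ n, IsTest (φ n)) ∧
    (∀ ε > 0, ∃ N, ∀ i ≥ N, ∀ j ≥ N, fracNorm μ (fun x => φ i x - φ j x) < ε) ∧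
    Tendsto (fun n => l2Norm (fun x => φ n x - w x)) atTop (𝓝 0)

/-- The left fractional integral of order `σ` on `(0,1)`, from `0` to `x`. -/
def leftI (σ : ℝ) (w : ℝ → ℝ) (x : ℝ) : ℝ :=
  1 / Real.Gamma σ * ∫ s in (0 : ℝ)..x, w s / (x - s) ^ (1 - σ)

/-- The right fractional integral of order `σ` on `(0,1)`, from `x` to `1`. -/
def rightI (σ : ℝ) (w : ℝ → ℝ) (x : ℝ) : ℝ :=
  1 / Real.Gamma σ * ∫ s in x..(1 : ℝ), w s / (s - x) ^ (1 - σ)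

/-- The two-sided fractional integral `I^β_θ`. -/
def iTheta (β θ : ℝ) (w : ℝ → ℝ) (x : ℝ) : ℝ :=
  θ * leftI β w x + (1 - θ) * rightI β w x

/-- `u ∈ H^{1-β}_0(0,1)` is a weak solution of `-D(K D I^β_θ u) = f`, `u(0) = u(1) = 0`, in the
Petrov-Galerkin sense, for `f ∈ L²(0,1)`:
`(K D I^β_θ u, Dv)_{L²} = (f, v)_{L²}` for all `v ∈ H^1_0(0,1)`. -/
def IsWeakSolution (β θ : ℝ) (K f u : ℝ → ℝ) : Prop :=
  MemH0 (1 - β) u ∧ ∀ v : ℝ → ℝ, MemH0 1 v →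
    ∫ x in Ioo (0 : ℝ) 1, K x * weakDeriv 1 (iTheta β θ u) x * weakDeriv 1 v x =
      ∫ x in Ioo (0 : ℝ) 1, f x * v x

/-- The solution `w_l` of `(K w_l')' = 0`, `w_l(0) = 1`, `w_l(1) = 0`. -/
def wl (K : ℝ → ℝ) (x : ℝ) : ℝ :=
  (∫ s in (0 : ℝ)..1, 1 / K s)⁻¹ * ∫ s in x..(1 : ℝ), 1 / K s

/-- `p` is the function `u_l ∈ H^{1-β}_0(0,1)` attached to `K`: on `[0,1]`,
`I^β_θ p - (1-θ) (rightI p)(0) (1-x) - θ (leftI p)(1) x = w_l - (1-x)`. -/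
def IsUl (β θ : ℝ) (K p : ℝ → ℝ) : Prop :=
  MemH0 (1 - β) p ∧ ∀ x ∈ Icc (0 : ℝ) 1,
    iTheta β θ p x - (1 - θ) * rightI β p 0 * (1 - x) - θ * leftI β p 1 * x =
      wl K x - (1 - x)

/-- The solvability condition `1 + θ (leftI u_l)(1) - (1-θ) (rightI u_l)(0) ≠ 0`. -/
def SolvCond (β θ : ℝ) (K : ℝ → ℝ) : Prop :=
  ∀ p : ℝ → ℝ, IsUl β θ K p → 1 + θ * leftI β p 1 - (1 - θ) * rightI β p 0 ≠ 0

end FracDiff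

end

open FracDiff

namespace FracDiff

/-! The equation says that the flux `K D I^β_θ u` has weak derivative `-f`. Hence, once `I^β_θ u`
and its flux are bounded in `L²` by `f`, regularity is an ordinary bootstrap: `f ∈ H^m` puts the
flux in `H^{m+1}`, multiplication by `1/K ∈ C^{m+1}` keeps `D I^β_θ u` there, and one integration
gives `H^{m+2}`. The real issue is to control two constants of integration, that of the flux and
that of `I^β_θ u` itself, uniformly in `u`.

Both are fixed by a positive weight `ρ(x) = x^a (1-x)^b`, `a + b = -β`, on which the adjoint of
`I^β_θ` is a constant `c` (`exists_weight`). For a test function `φ` this gives `∫ (I φ) ρ = c ∫ φ`.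
Applied to `φ'` it yields `∫ (I φ)' ρ = 0`. Applied to `s φ'`, with the commutator `I(s φ') = x (I
φ)' - β I φ`, it yields `(1-β) ∫ (I φ) ρ = -∫ (I φ)' x ρ`. The first moment determines the constant
of the flux and the second that of `I φ`. Positivity of `ρ` turns both identities into weighted
averages, hence into explicit bounds (`IsWeakSolution.exists_apriori`).

The identities pass to `u ∈ H^{1-β}_0` by density (`MemH0.iTheta_structure`): the Fourier transform
of the kernel is `O(|ω|^{-β})`, so `‖(I φ)'‖_{L²}` is bounded by the `H^{1-β}` norm of `φ`. The
resulting estimate is linear in `f` alone; the norm of `K` on the right only enlarges the bound. -/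

/-! ### Test functions and weak derivatives -/

lemma setIntegral_Ioo_eq (f : ℝ → ℝ) :
    ∫ x in Ioo (0 : ℝ) 1, f x = ∫ x in (0 : ℝ)..1, f x := by
  rw [intervalIntegral.integral_of_le zero_le_one, integral_Ioc_eq_integral_Ioo]

lemma IsTest.eq_zero {φ : ℝ → ℝ} (h : IsTest φ) {x : ℝ} (hx : x ∉ Ioo (0 : ℝ) 1) : φ x = 0 :=
  image_eq_zero_of_notMem_tsupport fun h' => hx (h.2.2 h')

lemma IsTest.continuous {φ : ℝ → ℝ} (h : IsTest φ) : Continuous φ := h.1.continuous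

lemma IsTest.differentiable {φ : ℝ → ℝ} (h : IsTest φ) : Differentiable ℝ φ :=
  h.1.differentiable (by simp)

lemma IsTest.isTest_deriv {φ : ℝ → ℝ} (h : IsTest φ) : IsTest (deriv φ) :=
  ⟨(contDiff_infty_iff_deriv.1 h.1).2, h.2.1.deriv, (tsupport_deriv_subset).trans h.2.2⟩

lemma IsTest.sub {φ ψ : ℝ → ℝ} (h : IsTest φ) (h' : IsTest ψ) :
    IsTest (fun x => φ x - ψ x) :=
  ⟨h.1.sub h'.1, h.2.1.sub h'.2.1, (tsupport_sub φ ψ).trans (union_subset h.2.2 h'.2.2)⟩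

lemma IsTest.const_mul {φ : ℝ → ℝ} (h : IsTest φ) (c : ℝ) : IsTest (fun x => c * φ x) :=
  ⟨contDiff_const.mul h.1, h.2.1.mul_left, (tsupport_mul_subset_right).trans h.2.2⟩

lemma IsTest.integrable {φ : ℝ → ℝ} (h : IsTest φ) : Integrable φ :=
  h.continuous.integrable_of_hasCompactSupport h.2.1

lemma IsTest.setIntegral_eq {φ : ℝ → ℝ} (h : IsTest φ) (w : ℝ → ℝ) :
    ∫ x in Ioo (0 : ℝ) 1, w x * φ x = ∫ x, w x * φ x :=
  setIntegral_eq_integral_of_forall_compl_eq_zero fun _ hx => by rw [h.eq_zero hx, mul_zero]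

lemma IsTest.setIntegral_eq' {φ : ℝ → ℝ} (h : IsTest φ) :
    ∫ x in Ioo (0 : ℝ) 1, φ x = ∫ x, φ x :=
  setIntegral_eq_integral_of_forall_compl_eq_zero fun _ hx => h.eq_zero hx

lemma IsTest.integrable_mul {φ w : ℝ → ℝ} (h : IsTest φ)
    (hw : LocallyIntegrableOn w (Ioo 0 1)) : Integrable (fun x => w x * φ x) := by
  have h1 : IntegrableOn w (tsupport φ) := hw.integrableOn_compact_subset h.2.2 h.2.1
  have h2 : IntegrableOn (fun x => w x * φ x) (tsupport φ) :=
    h1.mul_continuousOn h.continuous.continuousOn h.2.1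
  refine (integrableOn_iff_integrable_of_support_subset ?_).1 h2
  intro x hx
  exact subset_tsupport _ (right_ne_zero_of_mul hx)

lemma ae_eq_of_forall_test {w w' : ℝ → ℝ} (hw : LocallyIntegrableOn w (Ioo 0 1))
    (hw' : LocallyIntegrableOn w' (Ioo 0 1))
    (h : ∀ φ, IsTest φ → ∫ x in Ioo (0 : ℝ) 1, w x * φ x = ∫ x in Ioo (0 : ℝ) 1, w' x * φ x) :
    w =ᵐ[vol01] w' := by
  have := isOpen_Ioo.ae_eq_zero_of_integral_contDiff_smul_eq_zero (μ := volume) (hw.sub hw')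
    (fun φ h1 h2 h3 => by
      have hφ : IsTest φ := ⟨h1, h2, h3⟩
      have e := h φ hφ
      rw [hφ.setIntegral_eq, hφ.setIntegral_eq] at e
      have : ∀ x, φ x • (w - w') x = w x * φ x - w' x * φ x := fun x => by
        simp only [smul_eq_mul, Pi.sub_apply]; ring
      simp_rw [this]
      rw [integral_sub (hφ.integrable_mul hw) (hφ.integrable_mul hw'), e, sub_self])
  refine (ae_restrict_iff' measurableSet_Ioo).2 ?_
  filter_upwards [this] with x hx hx1
  have := hx hx1
  simpa [sub_eq_zero] using this

lemma HasWeakDeriv.ae_unique {k : ℕ} {w g g' : ℝ → ℝ} (h : HasWeakDeriv k w g)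
    (h' : HasWeakDeriv k w g') : g =ᵐ[vol01] g' :=
  ae_eq_of_forall_test h.2.1 h'.2.1 fun φ hφ =>
    mul_left_cancel₀ (pow_ne_zero k (by norm_num : (-1 : ℝ) ≠ 0))
      ((h.2.2 φ hφ).symm.trans (h'.2.2 φ hφ))

lemma locallyIntegrableOn_congr {w w' : ℝ → ℝ} (hw : LocallyIntegrableOn w (Ioo 0 1))
    (h : w =ᵐ[vol01] w') : LocallyIntegrableOn w' (Ioo 0 1) := by
  rw [locallyIntegrableOn_iff isOpen_Ioo.isLocallyClosed] at hw ⊢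
  exact fun k hk hc =>
    (hw k hk hc).congr_fun_ae (ae_restrict_of_ae_restrict_of_subset hk h)

lemma HasWeakDeriv.congr {k : ℕ} {w w' g g' : ℝ → ℝ} (h : HasWeakDeriv k w g)
    (hw : w =ᵐ[vol01] w') (hg : g =ᵐ[vol01] g') : HasWeakDeriv k w' g' := by
  refine ⟨locallyIntegrableOn_congr h.1 hw, locallyIntegrableOn_congr h.2.1 hg, fun φ hφ => ?_⟩
  have e1 : ∫ x in Ioo (0 : ℝ) 1, w' x * iteratedDeriv k φ x =
      ∫ x in Ioo (0 : ℝ) 1, w x * iteratedDeriv k φ x :=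
    integral_congr_ae (by filter_upwards [hw] with x hx; rw [hx])
  have e2 : ∫ x in Ioo (0 : ℝ) 1, g' x * φ x = ∫ x in Ioo (0 : ℝ) 1, g x * φ x :=
    integral_congr_ae (by filter_upwards [hg] with x hx; rw [hx])
  rw [e1, e2, h.2.2 φ hφ]

lemma weakDeriv_spec {k : ℕ} {w g : ℝ → ℝ} (h : HasWeakDeriv k w g) :
    HasWeakDeriv k w (weakDeriv k w) := by
  have h' : ∃ g, HasWeakDeriv k w g := ⟨g, h⟩
  rw [weakDeriv, dif_pos h']
  exact h'.choose_spec

lemma weakDeriv_ae_eq {k : ℕ} {w g : ℝ → ℝ} (h : HasWeakDeriv k w g) :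
    weakDeriv k w =ᵐ[vol01] g := (weakDeriv_spec h).ae_unique h

lemma HasWeakDeriv.succ {k : ℕ} {w g g' : ℝ → ℝ} (h : HasWeakDeriv 1 w g)
    (h' : HasWeakDeriv k g g') : HasWeakDeriv (k + 1) w g' := by
  refine ⟨h.1, h'.2.1, fun φ hφ => ?_⟩
  have hk : ∀ k, IsTest (iteratedDeriv k φ) := by
    intro k
    induction k with
    | zero => simpa using hφ
    | succ n ih => rw [iteratedDeriv_succ]; exact ih.isTest_deriv
  have e := h.2.2 _ (hk k)
  rw [iteratedDeriv_one] at e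
  rw [iteratedDeriv_succ, e, h'.2.2 φ hφ]
  ring

/-- Membership in `H^m` supplies the derivative of each order separately; testing against `φ'` links
two consecutive orders. -/
lemma HasWeakDeriv.of_succ {k : ℕ} {w g g' : ℝ → ℝ} (h : HasWeakDeriv k w g)
    (h' : HasWeakDeriv (k + 1) w g') : HasWeakDeriv 1 g g' := by
  refine ⟨h.2.1, h'.2.1, fun φ hφ => ?_⟩
  have e1 := h.2.2 _ hφ.isTest_deriv
  have e2 := h'.2.2 _ hφ
  rw [iteratedDeriv_succ'] at e2
  rw [e2] at e1
  rw [iteratedDeriv_one]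
  refine mul_left_cancel₀ (pow_ne_zero k (by norm_num : (-1 : ℝ) ≠ 0)) ?_
  rw [← e1]; ring

lemma HasWeakDeriv.zero {w : ℝ → ℝ} (h : LocallyIntegrableOn w (Ioo 0 1)) :
    HasWeakDeriv 0 w w := ⟨h, h, fun φ _ => by simp⟩

lemma HasWeakDeriv.add {k : ℕ} {w g w' g' : ℝ → ℝ} (h : HasWeakDeriv k w g)
    (h' : HasWeakDeriv k w' g') :
    HasWeakDeriv k (fun x => w x + w' x) (fun x => g x + g' x) := by
  refine ⟨h.1.add h'.1, h.2.1.add h'.2.1, fun φ hφ => ?_⟩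
  have hk : ∀ k, IsTest (iteratedDeriv k φ) := by
    intro k
    induction k with
    | zero => simpa using hφ
    | succ n ih => rw [iteratedDeriv_succ]; exact ih.isTest_deriv
  simp_rw [add_mul]
  rw [integral_add ((hk k).integrable_mul h.1).integrableOn
    ((hk k).integrable_mul h'.1).integrableOn, integral_add (hφ.integrable_mul h.2.1).integrableOn
    (hφ.integrable_mul h'.2.1).integrableOn, h.2.2 φ hφ, h'.2.2 φ hφ, mul_add]

lemma HasWeakDeriv.neg {k : ℕ} {w g : ℝ → ℝ} (h : HasWeakDeriv k w g) :
    HasWeakDeriv k (fun x => - w x) (fun x => - g x) := by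
  refine ⟨h.1.neg, h.2.1.neg, fun φ hφ => ?_⟩
  simp_rw [neg_mul, integral_neg, h.2.2 φ hφ, mul_neg]

lemma exists_isTest_integral_eq_one : ∃ η : ℝ → ℝ, IsTest η ∧ ∫ x, η x = 1 := by
  let b : ContDiffBump (1 / 2 : ℝ) := ⟨1 / 8, 1 / 4, by norm_num, by norm_num⟩
  refine ⟨b.normed volume, ⟨b.contDiff_normed, b.hasCompactSupport_normed, ?_⟩, b.integral_normed⟩
  rw [b.tsupport_normed_eq, Real.closedBall_eq_Icc]
  refine Icc_subset_Ioo ?_ ?_ <;> norm_num [b]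

/-- Mean zero makes the primitive from `0` vanish to the right of the support as well as to the
left. -/
lemma IsTest.exists_primitive {φ : ℝ → ℝ} (h : IsTest φ) (h0 : ∫ x, φ x = 0) :
    ∃ ψ, IsTest ψ ∧ deriv ψ = φ := by
  have hd : ∀ x, HasDerivAt (fun x => ∫ s in (0 : ℝ)..x, φ s) (φ x) x := fun x =>
    intervalIntegral.integral_hasDerivAt_right (h.continuous.intervalIntegrable _ _)
      h.continuous.stronglyMeasurable.stronglyMeasurableAtFilter h.continuous.continuousAt
  have hde : deriv (fun x => ∫ s in (0 : ℝ)..x, φ s) = φ := funext fun x => (hd x).deriv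
  -- The point `1/2` is added so that the compact set has a least and a greatest element even when
  -- `φ = 0`.
  have hc : IsCompact (tsupport φ ∪ {1 / 2}) := h.2.1.isCompact.union isCompact_singleton
  have hne : (tsupport φ ∪ {1 / 2}).Nonempty := ⟨1 / 2, by simp⟩
  have hsub : tsupport φ ∪ {1 / 2} ⊆ Ioo 0 1 :=
    union_subset h.2.2 (by rw [singleton_subset_iff]; constructor <;> norm_num)
  obtain ⟨a, ha, ha'⟩ := hc.exists_isLeast hne
  obtain ⟨b, hb, hb'⟩ := hc.exists_isGreatest hne
  have hz : ∀ x, x ∉ Icc a b → φ x = 0 := fun x hx =>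
    image_eq_zero_of_notMem_tsupport fun h' => hx ⟨ha' (Or.inl h'), hb' (Or.inl h')⟩
  have hsupp : Function.support (fun x => ∫ s in (0 : ℝ)..x, φ s) ⊆ Icc a b := by
    intro x hx
    by_contra hxn
    apply hx
    rw [mem_Icc, not_and_or, not_le, not_le] at hxn
    have ha0 := (hsub ha).1
    have hb1 := (hsub hb).2
    rcases hxn with hxa | hxb
    · refine intervalIntegral.integral_zero_ae (Eventually.of_forall fun s hs => hz s fun hs' => ?_)
      rcases mem_uIoc.1 hs with h1 | h1 <;> linarith [hs'.1, h1.2]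
    · have : ∫ s in (0 : ℝ)..x, φ s = ∫ s, φ s := by
        rw [intervalIntegral.integral_of_le (by linarith [(hsub hb).1])]
        refine setIntegral_eq_integral_of_forall_compl_eq_zero fun s hs => hz s fun hs' => hs ⟨?_, ?_⟩
        · linarith [hs'.1]
        · linarith [hs'.2]
      simpa using this.trans h0
  refine ⟨_, ⟨?_, ?_, ?_⟩, hde⟩
  · exact contDiff_infty_iff_deriv.2 ⟨fun x => (hd x).differentiableAt, by rw [hde]; exact h.1⟩
  · exact HasCompactSupport.of_support_subset_isCompact isCompact_Icc hsupp
  · exact (closure_minimal hsupp isClosed_Icc).trans (Icc_subset_Ioo (hsub ha).1 (hsub hb).2)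

/-- Du Bois-Reymond: subtracting `(∫ φ) η`, with `∫ η = 1`, leaves a test function of mean zero,
which is the derivative of a test function. The constant is therefore `∫ w η`. -/
lemma HasWeakDeriv.ae_const {w : ℝ → ℝ} (h : HasWeakDeriv 1 w 0) :
    ∃ c : ℝ, w =ᵐ[vol01] fun _ => c := by
  obtain ⟨η, hη, hη1⟩ := exists_isTest_integral_eq_one
  refine ⟨∫ x in Ioo (0 : ℝ) 1, w x * η x, ae_eq_of_forall_test h.1
    (continuousOn_const.locallyIntegrableOn measurableSet_Ioo) fun φ hφ => ?_⟩
  have ht : IsTest (fun x => φ x - (∫ x, φ x) * η x) := hφ.sub (hη.const_mul _)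
  obtain ⟨ψ, hψ, hd⟩ := ht.exists_primitive (by
    rw [integral_sub hφ.integrable (hη.const_mul _).integrable, integral_const_mul, hη1]; ring)
  have e := h.2.2 ψ hψ
  rw [iteratedDeriv_one, hd] at e
  simp only [Pi.zero_apply, zero_mul, integral_zero, mul_zero] at e
  have e2 : ∀ x, w x * (φ x - (∫ x, φ x) * η x) = w x * φ x - (∫ x, φ x) * (w x * η x) :=
    fun x => by ring
  simp_rw [e2] at e
  rw [integral_sub (hφ.integrable_mul h.1).integrableOn
    ((hη.integrable_mul h.1).const_mul _).integrableOn, integral_const_mul] at e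
  rw [integral_const_mul, hφ.setIntegral_eq']
  linarith

lemma locallyIntegrableOn_of_intervalIntegrable {w : ℝ → ℝ}
    (h : IntervalIntegrable w volume 0 1) : LocallyIntegrableOn w (Ioo 0 1) :=
  (((intervalIntegrable_iff_integrableOn_Ioo_of_le zero_le_one).1 h)).locallyIntegrableOn

/-- An absolutely continuous function has its a.e. derivative as weak derivative. -/
lemma hasWeakDeriv_of_ac {v : ℝ → ℝ} (hv : AbsolutelyContinuousOnInterval v 0 1) :
    HasWeakDeriv 1 v (deriv v) := by
  refine ⟨locallyIntegrableOn_of_intervalIntegrable hv.continuousOn.intervalIntegrable,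
    locallyIntegrableOn_of_intervalIntegrable hv.intervalIntegrable_deriv, fun φ hφ => ?_⟩
  have hac : AbsolutelyContinuousOnInterval φ 0 1 :=
    (hφ.1.of_le (by simp)).contDiffOn.absolutelyContinuousOnInterval
  rw [setIntegral_Ioo_eq, setIntegral_Ioo_eq, iteratedDeriv_one,
    hv.integral_mul_deriv_eq_deriv_mul hac, hφ.eq_zero (x := 0) (by simp),
    hφ.eq_zero (x := 1) (by simp)]
  simp

lemma ae_deriv_primitive {g : ℝ → ℝ} (hg : IntegrableOn g (Ioo 0 1)) (c : ℝ) :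
    deriv (fun x => c + ∫ s in (0 : ℝ)..x, g s) =ᵐ[vol01] g := by
  have hi := (intervalIntegrable_iff_integrableOn_Ioo_of_le zero_le_one).2 hg
  refine (ae_restrict_iff' measurableSet_Ioo).2 ?_
  filter_upwards [hi.ae_hasDerivAt_integral] with x hx hx1
  have := hx (by rw [uIcc_of_le zero_le_one]; exact Ioo_subset_Icc_self hx1) 0 (by simp)
  exact (this.const_add c).deriv

lemma ac_primitive {g : ℝ → ℝ} (hg : IntegrableOn g (Ioo 0 1)) (c : ℝ) :
    AbsolutelyContinuousOnInterval (fun x => c + ∫ s in (0 : ℝ)..x, g s) 0 1 := by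
  have hi := (intervalIntegrable_iff_integrableOn_Ioo_of_le zero_le_one).2 hg
  have h1 : AbsolutelyContinuousOnInterval (fun _ : ℝ => c) 0 1 :=
    contDiffOn_const.absolutelyContinuousOnInterval
  exact h1.add (hi.absolutelyContinuousOnInterval_intervalIntegral (by simp))

lemma hasWeakDeriv_primitive {g : ℝ → ℝ} (hg : IntegrableOn g (Ioo 0 1)) (c : ℝ) :
    HasWeakDeriv 1 (fun x => c + ∫ s in (0 : ℝ)..x, g s) g :=
  (hasWeakDeriv_of_ac (ac_primitive hg c)).congr (ae_eq_refl _) (ae_deriv_primitive hg c)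

/-- A function with integrable weak derivative agrees a.e. with a primitive of it. -/
lemma HasWeakDeriv.exists_primitive {w g : ℝ → ℝ} (h : HasWeakDeriv 1 w g)
    (hg : IntegrableOn g (Ioo 0 1)) :
    ∃ c : ℝ, w =ᵐ[vol01] fun x => c + ∫ s in (0 : ℝ)..x, g s := by
  have h1 := h.add (hasWeakDeriv_primitive hg 0).neg
  obtain ⟨c, hc⟩ := (h1.congr (g' := 0) (ae_eq_refl _) (by simp; rfl)).ae_const
  refine ⟨c, ?_⟩
  filter_upwards [hc] with x hx
  linarith

/-! ### The `L²(0,1)` norm -/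

instance : IsProbabilityMeasure vol01 := ⟨by simp [vol01]⟩

lemma integral_vol01 (f : ℝ → ℝ) : ∫ x, f x ∂vol01 = ∫ x in Ioo (0 : ℝ) 1, f x := rfl

lemma l2Norm_nonneg (w : ℝ → ℝ) : 0 ≤ l2Norm w := Real.sqrt_nonneg _

lemma l2Norm_congr {w w' : ℝ → ℝ} (h : w =ᵐ[vol01] w') : l2Norm w = l2Norm w' := by
  rw [l2Norm, l2Norm, ← integral_vol01, ← integral_vol01]
  congr 1
  exact integral_congr_ae (by filter_upwards [h] with x hx; rw [hx])

lemma l2Norm_eq_eLpNorm {w : ℝ → ℝ} (h : MemLp w 2 vol01) :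
    l2Norm w = (eLpNorm w 2 vol01).toReal := by
  rw [h.eLpNorm_eq_integral_rpow_norm (by norm_num) (by norm_num), ENNReal.toReal_ofReal
    (by positivity), l2Norm, Real.sqrt_eq_rpow]
  simp [← integral_vol01]

lemma l2Norm_add_le {w w' : ℝ → ℝ} (h : MemLp w 2 vol01) (h' : MemLp w' 2 vol01) :
    l2Norm (fun x => w x + w' x) ≤ l2Norm w + l2Norm w' := by
  have h'' : MemLp (fun x => w x + w' x) 2 vol01 := h.add h'
  rw [l2Norm_eq_eLpNorm h, l2Norm_eq_eLpNorm h', l2Norm_eq_eLpNorm h'',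
    ← ENNReal.toReal_add h.eLpNorm_ne_top h'.eLpNorm_ne_top]
  exact ENNReal.toReal_mono (by simp [h.eLpNorm_ne_top, h'.eLpNorm_ne_top])
    (eLpNorm_add_le h.1 h'.1 (by norm_num))

lemma memLp_of_bound {w : ℝ → ℝ} {C : ℝ} (hw : AEStronglyMeasurable w vol01)
    (hC : ∀ᵐ x ∂vol01, |w x| ≤ C) : MemLp w 2 vol01 := MemLp.of_bound hw C hC

lemma l2Norm_le_of_bound {w : ℝ → ℝ} {C : ℝ} (hC0 : 0 ≤ C)
    (hC : ∀ᵐ x ∂vol01, |w x| ≤ C) : l2Norm w ≤ C := by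
  refine Real.sqrt_le_iff.2 ⟨hC0, ?_⟩
  have : ∫ x, w x ^ 2 ∂vol01 ≤ ∫ _, C ^ 2 ∂vol01 := by
    refine integral_mono_of_nonneg (ae_of_all _ fun x => sq_nonneg _) (integrable_const _) ?_
    filter_upwards [hC] with x hx
    exact sq_le_sq' (abs_le.1 hx).1 (abs_le.1 hx).2
  simpa [integral_vol01] using this

lemma MemLp.bdd_mul_vol01 {w R : ℝ → ℝ} {C : ℝ} (h : MemLp w 2 vol01)
    (hR : AEStronglyMeasurable R vol01) (hC : ∀ᵐ x ∂vol01, |R x| ≤ C) :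
    MemLp (fun x => R x * w x) 2 vol01 := by
  refine h.of_le_mul (c := C) (hR.mul h.1) ?_
  filter_upwards [hC] with x hx
  rw [norm_mul]
  exact mul_le_mul_of_nonneg_right hx (norm_nonneg _)

lemma l2Norm_mul_le {w R : ℝ → ℝ} {C : ℝ} (h : MemLp w 2 vol01) (hC0 : 0 ≤ C)
    (hC : ∀ᵐ x ∂vol01, |R x| ≤ C) : l2Norm (fun x => R x * w x) ≤ C * l2Norm w := by
  rw [l2Norm, l2Norm, ← Real.sqrt_sq hC0, ← Real.sqrt_mul (sq_nonneg C)]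
  refine Real.sqrt_le_sqrt ?_
  rw [← integral_vol01, ← integral_vol01, ← integral_const_mul]
  refine integral_mono_of_nonneg (ae_of_all _ fun x => sq_nonneg _)
    (h.integrable_sq.const_mul _) ?_
  filter_upwards [hC] with x hx
  rw [mul_pow]
  exact mul_le_mul_of_nonneg_right (sq_le_sq' (abs_le.1 hx).1 (abs_le.1 hx).2) (sq_nonneg _)

lemma abs_integral_mul_le_l2Norm {w w' : ℝ → ℝ} (h : MemLp w 2 vol01) (h' : MemLp w' 2 vol01) :
    |∫ x in Ioo (0 : ℝ) 1, w x * w' x| ≤ l2Norm w * l2Norm w' := by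
  have := integral_mul_norm_le_Lp_mul_Lq (μ := vol01) (f := w) (g := w') (p := 2) (q := 2)
    Real.HolderConjugate.two_two (by simpa using h) (by simpa using h')
  rw [l2Norm, l2Norm, Real.sqrt_eq_rpow, Real.sqrt_eq_rpow, ← integral_vol01, ← integral_vol01,
    ← integral_vol01]
  refine (abs_integral_le_integral_abs).trans ?_
  simpa [abs_mul] using this

lemma integral_abs_le_l2Norm {w : ℝ → ℝ} (h : MemLp w 2 vol01) :
    ∫ x in Ioo (0 : ℝ) 1, |w x| ≤ l2Norm w := by
  have := abs_integral_mul_le_l2Norm (w := fun x => |w x|) (w' := fun _ => 1) h.abs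
    (memLp_const 1)
  have e : l2Norm (fun x => |w x|) = l2Norm w := by simp [l2Norm]
  have e1 : l2Norm (fun _ => (1 : ℝ)) = 1 := by simp [l2Norm]
  rw [e, e1] at this
  simpa using (le_abs_self _).trans this

lemma abs_primitive_le_l2Norm {w : ℝ → ℝ} (h : MemLp w 2 vol01) {x : ℝ} (hx : x ∈ Ioo (0 : ℝ) 1) :
    |∫ s in (0 : ℝ)..x, w s| ≤ l2Norm w := by
  refine le_trans ?_ (integral_abs_le_l2Norm h)
  have hi : IntegrableOn (fun x => |w x|) (Ioo 0 1) := (h.integrable one_le_two).abs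
  refine (intervalIntegral.abs_integral_le_integral_abs hx.1.le).trans ?_
  rw [intervalIntegral.integral_of_le hx.1.le]
  exact setIntegral_mono_set hi (ae_of_all _ fun x => abs_nonneg _)
    (Ioc_subset_Ioo_right hx.2).eventuallyLE

/-! ### Sobolev bounds along a chain of first-order derivatives -/

/-- `w` has weak derivatives up to order `n`, all bounded by `M` in `L²(0,1)`. -/
def SobolevBound : ℕ → (ℝ → ℝ) → ℝ → Prop
  | 0, w, M => MemLp w 2 vol01 ∧ l2Norm w ≤ M
  | n + 1, w, M => (MemLp w 2 vol01 ∧ l2Norm w ≤ M) ∧ ∃ g, HasWeakDeriv 1 w g ∧ SobolevBound n g M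

namespace SobolevBound

lemma base {n : ℕ} {w : ℝ → ℝ} {M : ℝ} (h : SobolevBound n w M) :
    MemLp w 2 vol01 ∧ l2Norm w ≤ M := by
  cases n with
  | zero => exact h
  | succ n => exact h.1

lemma nonneg {n : ℕ} {w : ℝ → ℝ} {M : ℝ} (h : SobolevBound n w M) : 0 ≤ M :=
  (l2Norm_nonneg w).trans h.base.2

lemma mono {n : ℕ} {w : ℝ → ℝ} {M M' : ℝ} (h : SobolevBound n w M) (hM : M ≤ M') :
    SobolevBound n w M' := by
  induction n generalizing w with
  | zero => exact ⟨h.1, h.2.trans hM⟩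
  | succ n ih =>
    obtain ⟨h1, g, h2, h3⟩ := h
    exact ⟨⟨h1.1, h1.2.trans hM⟩, g, h2, ih h3⟩

lemma of_succ {n : ℕ} {w : ℝ → ℝ} {M : ℝ} (h : SobolevBound (n + 1) w M) :
    SobolevBound n w M := by
  induction n generalizing w with
  | zero => exact h.1
  | succ n ih =>
    obtain ⟨h1, g, h2, h3⟩ := h
    exact ⟨h1, g, h2, ih h3⟩

lemma congr {n : ℕ} {w w' : ℝ → ℝ} {M : ℝ} (h : SobolevBound n w M) (hw : w =ᵐ[vol01] w') :
    SobolevBound n w' M := by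
  cases n with
  | zero => exact ⟨(memLp_congr_ae hw).1 h.1, (l2Norm_congr hw) ▸ h.2⟩
  | succ n =>
    obtain ⟨h1, g, h2, h3⟩ := h
    exact ⟨⟨(memLp_congr_ae hw).1 h1.1, (l2Norm_congr hw) ▸ h1.2⟩, g,
      h2.congr hw (ae_eq_refl _), h3⟩

lemma add {n : ℕ} {w w' : ℝ → ℝ} {M M' : ℝ} (h : SobolevBound n w M)
    (h' : SobolevBound n w' M') : SobolevBound n (fun x => w x + w' x) (M + M') := by
  induction n generalizing w w' with
  | zero => exact ⟨h.1.add h'.1, (l2Norm_add_le h.1 h'.1).trans (add_le_add h.2 h'.2)⟩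
  | succ n ih =>
    obtain ⟨h1, g, h2, h3⟩ := h
    obtain ⟨h1', g', h2', h3'⟩ := h'
    exact ⟨⟨h1.1.add h1'.1, (l2Norm_add_le h1.1 h1'.1).trans (add_le_add h1.2 h1'.2)⟩, _,
      h2.add h2', ih h3 h3'⟩

lemma neg {n : ℕ} {w : ℝ → ℝ} {M : ℝ} (h : SobolevBound n w M) :
    SobolevBound n (fun x => - w x) M := by
  have e : ∀ w : ℝ → ℝ, l2Norm (fun x => - w x) = l2Norm w := fun w => by simp [l2Norm]
  induction n generalizing w with
  | zero => exact ⟨h.1.neg, (e w).trans_le h.2⟩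
  | succ n ih =>
    obtain ⟨h1, g, h2, h3⟩ := h
    exact ⟨⟨h1.1.neg, (e w).trans_le h1.2⟩, _, h2.neg, ih h3⟩

end SobolevBound

/-- `Z` is replaced by its absolutely continuous representative; a product of absolutely continuous
functions is absolutely continuous and obeys the Leibniz rule almost everywhere. -/
lemma HasWeakDeriv.mul {R Z g : ℝ → ℝ} (hR : ContDiffOn ℝ 1 R (Icc 0 1))
    (h : HasWeakDeriv 1 Z g) (hg : IntegrableOn g (Ioo 0 1)) :
    HasWeakDeriv 1 (fun x => R x * Z x)
      (fun x => derivWithin R (Icc 0 1) x * Z x + R x * g x) := by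
  obtain ⟨c, hc⟩ := h.exists_primitive hg
  have hac := ac_primitive hg c
  have hRac : AbsolutelyContinuousOnInterval R 0 1 :=
    ContDiffOn.absolutelyContinuousOnInterval (by rwa [uIcc_of_le zero_le_one])
  refine (hasWeakDeriv_of_ac (hRac.fun_mul hac)).congr ?_ ?_
  · filter_upwards [hc] with x hx
    rw [hx]
  · have hd : ∀ᵐ x ∂vol01, DifferentiableAt ℝ (fun x => c + ∫ s in (0 : ℝ)..x, g s) x := by
      refine (ae_restrict_iff' measurableSet_Ioo).2 ?_
      filter_upwards [hac.ae_differentiableAt] with x hx hx1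
      exact hx (by rw [uIcc_of_le zero_le_one]; exact Ioo_subset_Icc_self hx1)
    filter_upwards [hc, hd, ae_deriv_primitive hg c, ae_restrict_mem measurableSet_Ioo]
      with x hx hx1 hx2 hx3
    have hn : Icc (0 : ℝ) 1 ∈ 𝓝 x := Icc_mem_nhds hx3.1 hx3.2
    have hRd : DifferentiableAt ℝ R x :=
      (hR.differentiableOn one_ne_zero x (Ioo_subset_Icc_self hx3)).differentiableAt hn
    rw [deriv_fun_mul hRd hx1, hx2, hx, derivWithin_of_mem_nhds hn]

lemma exists_bound_of_continuousOn {R : ℝ → ℝ} (hR : ContinuousOn R (Icc 0 1)) :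
    ∃ C, 0 ≤ C ∧ (∀ᵐ x ∂vol01, |R x| ≤ C) ∧ AEStronglyMeasurable R vol01 := by
  obtain ⟨C, hC⟩ := isCompact_Icc.exists_bound_of_continuousOn hR
  refine ⟨C, (norm_nonneg _).trans (hC 0 (by simp)), ?_, ?_⟩
  · filter_upwards [ae_restrict_mem measurableSet_Ioo] with x hx
    exact hC x (Ioo_subset_Icc_self hx)
  · exact (hR.mono Ioo_subset_Icc_self).aestronglyMeasurable measurableSet_Ioo

/-- Multiplication by a `C^n[0,1]` function is bounded on `H^n(0,1)`. -/
lemma SobolevBound.exists_mul (n : ℕ) (R : ℝ → ℝ) (hR : ContDiffOn ℝ n R (Icc 0 1)) :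
    ∃ C, 0 ≤ C ∧ ∀ Z M, SobolevBound n Z M → SobolevBound n (fun x => R x * Z x) (C * M) := by
  induction n generalizing R with
  | zero =>
    obtain ⟨C, hC0, hC, hm⟩ := exists_bound_of_continuousOn hR.continuousOn
    exact ⟨C, hC0, fun Z M h => ⟨MemLp.bdd_mul_vol01 h.1 hm hC,
      (l2Norm_mul_le h.1 hC0 hC).trans (mul_le_mul_of_nonneg_left h.2 hC0)⟩⟩
  | succ n ih =>
    obtain ⟨C, hC0, hC, hm⟩ := exists_bound_of_continuousOn hR.continuousOn
    have hR' : ContDiffOn ℝ n (derivWithin R (Icc 0 1)) (Icc 0 1) :=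
      hR.derivWithin (uniqueDiffOn_Icc zero_lt_one) (by norm_cast)
    obtain ⟨C1, hC10, h1⟩ := ih _ hR'
    obtain ⟨C2, hC20, h2⟩ := ih R (hR.of_le (by norm_cast; omega))
    -- `C` serves `R Z` itself; `C1` and `C2` serve the terms `R' Z` and `R Z'` of its derivative.
    refine ⟨C + C1 + C2, by positivity, fun Z M h => ?_⟩
    have hM := h.nonneg
    have hZ := h.of_succ
    obtain ⟨h3, g, h4, h5⟩ := h
    refine ⟨⟨MemLp.bdd_mul_vol01 h3.1 hm hC, (l2Norm_mul_le h3.1 hC0 hC).trans ?_⟩, _,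
      h4.mul (hR.of_le (by norm_cast; omega)) (h5.base.1.integrable one_le_two),
      ((h1 _ _ hZ).add (h2 _ _ h5)).mono ?_⟩
    · nlinarith [mul_le_mul_of_nonneg_left h3.2 hC0, mul_nonneg hC10 hM, mul_nonneg hC20 hM]
    · nlinarith [mul_nonneg hC0 hM]

lemma MemLp.integrableOn_Ioo {w : ℝ → ℝ} (h : MemLp w 2 vol01) : IntegrableOn w (Ioo 0 1) :=
  h.integrable one_le_two

lemma MemLp.locallyIntegrableOn {w : ℝ → ℝ} (h : MemLp w 2 vol01) :
    LocallyIntegrableOn w (Ioo 0 1) := (MemLp.integrableOn_Ioo h).locallyIntegrableOn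

lemma SobolevBound.exists_hasWeakDeriv {n : ℕ} {w : ℝ → ℝ} {M : ℝ} (h : SobolevBound n w M)
    {k : ℕ} (hk : k ≤ n) : ∃ g, HasWeakDeriv k w g ∧ MemLp g 2 vol01 ∧ l2Norm g ≤ M := by
  induction n generalizing w k with
  | zero =>
    obtain rfl : k = 0 := by omega
    exact ⟨w, HasWeakDeriv.zero (MemLp.locallyIntegrableOn h.1),
      h.1, h.2⟩
  | succ n ih =>
    cases k with
    | zero =>
      exact ⟨w, HasWeakDeriv.zero
        (MemLp.locallyIntegrableOn h.1.1), h.1.1, h.1.2⟩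
    | succ k =>
      obtain ⟨h1, g, h2, h3⟩ := h
      obtain ⟨g', h4, h5⟩ := ih h3 (k := k) (by omega)
      exact ⟨g', h2.succ h4, h5⟩

lemma SobolevBound.memH {n : ℕ} {w : ℝ → ℝ} {M : ℝ} (h : SobolevBound n w M) : MemH n w :=
  fun _ hk => let ⟨g, h1, h2, _⟩ := h.exists_hasWeakDeriv hk; ⟨g, h1, h2⟩

lemma SobolevBound.weakDeriv_spec {n : ℕ} {w : ℝ → ℝ} {M : ℝ} (h : SobolevBound n w M)
    {k : ℕ} (hk : k ≤ n) : HasWeakDeriv k w (weakDeriv k w) ∧ MemLp (weakDeriv k w) 2 vol01 ∧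
      l2Norm (weakDeriv k w) ≤ M := by
  obtain ⟨g, h1, h2, h3⟩ := h.exists_hasWeakDeriv hk
  have e := weakDeriv_ae_eq h1
  exact ⟨FracDiff.weakDeriv_spec h1, (memLp_congr_ae e).2 h2, (l2Norm_congr e).trans_le h3⟩

/-- There are `n + 1` terms, each at most `M²`; the factor `√(n+1)` is rounded up to `n + 1`. -/
lemma SobolevBound.hNorm_le {n : ℕ} {w : ℝ → ℝ} {M : ℝ} (h : SobolevBound n w M) :
    hNorm n w ≤ (n + 1) * M := by
  have hM := h.nonneg
  refine Real.sqrt_le_iff.2 ⟨by positivity, ?_⟩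
  calc _ ≤ ∑ k ∈ Finset.range (n + 1), M ^ 2 := Finset.sum_le_sum fun k hk =>
        pow_le_pow_left₀ (l2Norm_nonneg _)
          (h.weakDeriv_spec (Nat.lt_succ_iff.1 (Finset.mem_range.1 hk))).2.2 2
    _ = (n + 1) * M ^ 2 := by simp
    _ ≤ _ := by
      rw [mul_pow]
      refine mul_le_mul_of_nonneg_right ?_ (sq_nonneg _)
      nlinarith [Nat.cast_nonneg (α := ℝ) n]

lemma l2Norm_weakDeriv_le_hNorm {n k : ℕ} (hk : k ≤ n) (w : ℝ → ℝ) :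
    l2Norm (weakDeriv k w) ≤ hNorm n w :=
  Real.le_sqrt_of_sq_le (Finset.single_le_sum
    (f := fun k => l2Norm (weakDeriv k w) ^ 2) (fun _ _ => sq_nonneg _)
    (Finset.mem_range.2 (Nat.lt_succ_of_le hk)))

/-- Here `j` counts the derivatives still available after `k` have been taken, so the induction runs
from the top order down. -/
lemma MemH.sobolevBound_weakDeriv {m : ℕ} {f : ℝ → ℝ} (h : MemH m f) (j k : ℕ) (hjk : k + j = m) :
    SobolevBound j (weakDeriv k f) (hNorm m f) := by
  have base : ∀ k ≤ m, MemLp (weakDeriv k f) 2 vol01 ∧ l2Norm (weakDeriv k f) ≤ hNorm m f := by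
    intro k hk
    obtain ⟨g, h1, h2⟩ := h k hk
    exact ⟨(memLp_congr_ae (weakDeriv_ae_eq h1)).2 h2, l2Norm_weakDeriv_le_hNorm hk f⟩
  induction j generalizing k with
  | zero => exact base k (by omega)
  | succ j ih =>
    obtain ⟨g, h1, -⟩ := h k (by omega)
    obtain ⟨g', h1', -⟩ := h (k + 1) (by omega)
    exact ⟨base k (by omega), weakDeriv (k + 1) f,
      (FracDiff.weakDeriv_spec h1).of_succ (FracDiff.weakDeriv_spec h1'), ih (k + 1) (by omega)⟩

lemma MemH.sobolevBound {m : ℕ} {f : ℝ → ℝ} (h : MemH m f) : SobolevBound m f (hNorm m f) := by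
  refine (h.sobolevBound_weakDeriv m 0 (by omega)).congr ?_
  obtain ⟨g, h1, -⟩ := h 0 (by omega)
  exact weakDeriv_ae_eq (HasWeakDeriv.zero h1.1)

lemma cNorm_nonneg (n : ℕ) (K : ℝ → ℝ) : 0 ≤ cNorm n K :=
  Finset.sum_nonneg fun _ _ => Real.iSup_nonneg fun _ => abs_nonneg _

/-! ### The convolution kernel and its Fourier decay -/

/-- `t^(β-1)` on `(0,1)`, extended by zero. -/
noncomputable def truncPow (β t : ℝ) : ℝ := (Ioo (0 : ℝ) 1).indicator (fun t => t ^ (β - 1)) t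

/-- The convolution kernel of `I^β_θ` on `(0,1)`. -/
noncomputable def rieszKernel (β θ t : ℝ) : ℝ :=
  θ / Real.Gamma β * truncPow β t + (1 - θ) / Real.Gamma β * truncPow β (-t)

/-- Convolution with `rieszKernel`. -/
noncomputable def rieszConv (β θ : ℝ) (w : ℝ → ℝ) (x : ℝ) : ℝ :=
  ∫ t, rieszKernel β θ t * w (x - t)

lemma integrable_truncPow {β : ℝ} (hβ : 0 < β) : Integrable (truncPow β) := by
  have := intervalIntegral.intervalIntegrable_rpow' (a := 0) (b := 1) (r := β - 1) (by linarith)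
  rw [intervalIntegrable_iff_integrableOn_Ioo_of_le zero_le_one] at this
  exact this.integrable_indicator measurableSet_Ioo

lemma integrable_rieszKernel {β : ℝ} (hβ : 0 < β) (θ : ℝ) : Integrable (rieszKernel β θ) :=
  ((integrable_truncPow hβ).const_mul _).add ((integrable_truncPow hβ).comp_neg.const_mul _)

lemma norm_setIntegral_rpow_mul_exp_le {β : ℝ} (hβ : 0 < β) {δ : ℝ} (hδ : 0 ≤ δ) (ν : ℝ) :
    ‖∫ t in (0 : ℝ)..δ, ((t ^ (β - 1) : ℝ) : ℂ) * Complex.exp (ν * t * Complex.I)‖ ≤ δ ^ β / β := by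
  have e : ∫ t in (0 : ℝ)..δ, t ^ (β - 1) = δ ^ β / β := by
    rw [integral_rpow (Or.inl (by linarith))]
    simp [Real.zero_rpow hβ.ne']
  rw [← e]
  refine intervalIntegral.norm_integral_le_of_norm_le hδ (ae_of_all _ fun t ht => ?_)
    (intervalIntegral.intervalIntegrable_rpow' (by linarith))
  rw [norm_mul, ← Complex.ofReal_mul, Complex.norm_exp_ofReal_mul_I, mul_one, Complex.norm_real,
    Real.norm_of_nonneg (Real.rpow_nonneg ht.1.le _)]

/-- Integration by parts gains `1/|ν|`. The boundary terms contribute `|ν|⁻¹` and `|ν|^(-β)`, the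
remaining integral `|ν|^(-β) - |ν|⁻¹`, and the sum is exactly `2 |ν|^(-β)`. -/
lemma norm_integral_rpow_mul_exp_tail_le {β : ℝ} (hβ : 0 < β) (hβ1 : β < 1) {ν : ℝ}
    (hν : 1 ≤ |ν|) :
    ‖∫ t in (|ν|⁻¹)..1, ((t ^ (β - 1) : ℝ) : ℂ) * Complex.exp (ν * t * Complex.I)‖
      ≤ 2 * |ν| ^ (-β) := by
  have hν0 : 0 < |ν| := by linarith
  have hνc : (ν : ℂ) * Complex.I ≠ 0 :=
    mul_ne_zero (by exact_mod_cast abs_pos.1 hν0) Complex.I_ne_zero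
  have hδ0 : 0 < |ν|⁻¹ := inv_pos.2 hν0
  have hδ1 : |ν|⁻¹ ≤ 1 := inv_le_one_of_one_le₀ hν
  have hmem : ∀ t ∈ uIcc (|ν|⁻¹) 1, 0 < t := fun t ht => by
    rw [uIcc_of_le hδ1] at ht; exact hδ0.trans_le ht.1
  have hu : ∀ t ∈ uIcc (|ν|⁻¹) 1, HasDerivAt (fun t : ℝ => ((t ^ (β - 1) : ℝ) : ℂ))
      (((β - 1) * t ^ (β - 2) : ℝ) : ℂ) t := fun t ht => by
    have := (Real.hasDerivAt_rpow_const (p := β - 1) (Or.inl (hmem t ht).ne')).ofReal_comp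
    convert this using 4
    ring
  have hv : ∀ t ∈ uIcc (|ν|⁻¹) 1, HasDerivAt
      (fun t : ℝ => Complex.exp (ν * t * Complex.I) / (ν * Complex.I))
      (Complex.exp (ν * t * Complex.I)) t := fun t _ => by
    have h1 : HasDerivAt (fun t : ℝ => (ν * t * Complex.I : ℂ)) (ν * Complex.I) t := by
      have := ((hasDerivAt_id t).ofReal_comp.const_mul (ν : ℂ)).mul_const Complex.I
      simpa using this
    have := h1.cexp.div_const (ν * Complex.I)
    rwa [mul_div_cancel_right₀ _ hνc] at this
  have hcont : ContinuousOn (fun t : ℝ => t ^ (β - 2)) (uIcc (|ν|⁻¹) 1) := fun t ht =>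
    (Real.continuousAt_rpow_const _ _ (Or.inl (hmem t ht).ne')).continuousWithinAt
  rw [intervalIntegral.integral_mul_deriv_eq_deriv_mul hu hv
    (ContinuousOn.intervalIntegrable (by
      exact Complex.continuous_ofReal.comp_continuousOn (continuousOn_const.mul hcont)))
    (by apply Continuous.intervalIntegrable; fun_prop)]
  have hE : ∀ t : ℝ, ‖Complex.exp (ν * t * Complex.I) / (ν * Complex.I)‖ = |ν|⁻¹ := fun t => by
    rw [norm_div, ← Complex.ofReal_mul, Complex.norm_exp_ofReal_mul_I]
    simp
  have hpow : |ν|⁻¹ * (|ν|⁻¹) ^ (β - 1) = |ν| ^ (-β) := by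
    rw [← Real.rpow_one_add' hδ0.le, Real.inv_rpow hν0.le, Real.rpow_neg hν0.le]
    · ring_nf
    · exact (by linarith : 0 < 1 + (β - 1)).ne'
  have hI : ‖∫ t in (|ν|⁻¹)..1, (((β - 1) * t ^ (β - 2) : ℝ) : ℂ) *
      (Complex.exp (ν * t * Complex.I) / (ν * Complex.I))‖
      ≤ |ν|⁻¹ * ((|ν|⁻¹) ^ (β - 1) - 1) := by
    have e : ∫ t in (|ν|⁻¹)..1, |ν|⁻¹ * ((1 - β) * t ^ (β - 2)) =
        |ν|⁻¹ * ((|ν|⁻¹) ^ (β - 1) - 1) := by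
      rw [intervalIntegral.integral_const_mul, intervalIntegral.integral_const_mul,
        integral_rpow (Or.inr ⟨by linarith, fun h => (hmem 0 h).ne' rfl⟩), Real.one_rpow]
      have : β - 2 + 1 = β - 1 := by ring
      rw [this]
      have h1 : β - 1 ≠ 0 := by linarith
      field_simp
      ring
    rw [← e]
    refine intervalIntegral.norm_integral_le_of_norm_le hδ1 (ae_of_all _ fun t ht => ?_)
      (ContinuousOn.intervalIntegrable (continuousOn_const.mul (continuousOn_const.mul hcont)))
    rw [norm_mul, hE, Complex.norm_real, norm_mul, Real.norm_of_nonneg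
      (Real.rpow_nonneg (hδ0.trans ht.1).le _), Real.norm_of_nonpos (by linarith)]
    exact le_of_eq (by ring)
  refine (norm_sub_le _ _).trans ?_
  refine (add_le_add (norm_sub_le _ _) hI).trans ?_
  rw [norm_mul, norm_mul, hE, hE, Complex.norm_real, Complex.norm_real, Real.one_rpow, norm_one,
    Real.norm_of_nonneg (Real.rpow_nonneg hδ0.le _)]
  nlinarith

/-- The integral is cut at `t = 1/|ν|`: below it the absolute value suffices, above it the
oscillation is used. For `|ν| ≤ 1` no cut is needed, since then `|ν|^(-β) ≥ 1`. -/
lemma norm_integral_rpow_mul_exp_le {β : ℝ} (hβ : 0 < β) (hβ1 : β < 1) {ν : ℝ} (hν : ν ≠ 0) :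
    ‖∫ t in (0 : ℝ)..1, ((t ^ (β - 1) : ℝ) : ℂ) * Complex.exp (ν * t * Complex.I)‖
      ≤ (1 / β + 2) * |ν| ^ (-β) := by
  have hν0 : 0 < |ν| := abs_pos.2 hν
  have hp : 0 ≤ |ν| ^ (-β) := Real.rpow_nonneg hν0.le _
  have hβi : 0 < 1 / β := by positivity
  rcases le_total |ν| 1 with h | h
  · have h1 : 1 ≤ |ν| ^ (-β) := Real.one_le_rpow_of_pos_of_le_one_of_nonpos hν0 h (by linarith)
    refine (norm_setIntegral_rpow_mul_exp_le hβ zero_le_one ν).trans ?_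
    rw [Real.one_rpow]
    nlinarith
  · have hi : ∀ a b : ℝ, IntervalIntegrable
        (fun t : ℝ => ((t ^ (β - 1) : ℝ) : ℂ) * Complex.exp (ν * t * Complex.I)) volume a b :=
      fun a b => by
        refine IntervalIntegrable.mul_continuousOn ?_ (by fun_prop)
        have := intervalIntegral.intervalIntegrable_rpow' (a := a) (b := b) (r := β - 1)
          (by linarith)
        exact ⟨this.1.ofReal, this.2.ofReal⟩
    rw [← intervalIntegral.integral_add_adjacent_intervals (hi 0 (|ν|⁻¹)) (hi _ 1)]
    refine (norm_add_le _ _).trans ?_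
    have h1 := norm_setIntegral_rpow_mul_exp_le hβ (inv_nonneg.2 hν0.le) ν
    have h2 := norm_integral_rpow_mul_exp_tail_le hβ hβ1 h
    rw [Real.inv_rpow hν0.le, ← Real.rpow_neg hν0.le] at h1
    calc _ ≤ _ := add_le_add h1 h2
      _ = _ := by ring

lemma norm_fourier_truncPow_le {β : ℝ} (hβ : 0 < β) (hβ1 : β < 1) {ξ : ℝ} (hξ : ξ ≠ 0) :
    ‖𝓕 (fun t => (truncPow β t : ℂ)) ξ‖ ≤ (1 / β + 2) * (2 * Real.pi * |ξ|) ^ (-β) := by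
  have h := norm_integral_rpow_mul_exp_le hβ hβ1 (ν := -(2 * Real.pi * ξ))
    (by simpa [Real.pi_ne_zero] using hξ)
  rw [abs_neg, abs_mul, abs_of_pos (by positivity : 0 < 2 * Real.pi)] at h
  convert h using 2
  rw [Real.fourier_real_eq_integral_exp_smul, intervalIntegral.integral_of_le zero_le_one,
    integral_Ioc_eq_integral_Ioo, ← integral_indicator measurableSet_Ioo]
  congr 1
  ext t
  by_cases ht : t ∈ Ioo (0 : ℝ) 1
  · rw [indicator_of_mem ht, truncPow, indicator_of_mem ht, smul_eq_mul, mul_comm]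
    congr 2
    push_cast
    ring
  · rw [indicator_of_notMem ht, truncPow, indicator_of_notMem ht]
    simp

lemma exists_norm_fourier_rieszKernel_le {β : ℝ} (hβ : 0 < β) (hβ1 : β < 1) (θ : ℝ) :
    ∃ C, 0 ≤ C ∧ ∀ ξ : ℝ, ξ ≠ 0 →
      ‖𝓕 (fun t => (rieszKernel β θ t : ℂ)) ξ‖ ≤ C * (2 * Real.pi * |ξ|) ^ (-β) := by
  refine ⟨(‖θ / Real.Gamma β‖ + ‖(1 - θ) / Real.Gamma β‖) * (1 / β + 2), by positivity,
    fun ξ hξ => ?_⟩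
  have hT := (integrable_truncPow hβ).ofReal (𝕜 := ℂ)
  have hneg : 𝓕 (fun t => (truncPow β (-t) : ℂ)) ξ = 𝓕 (fun t => (truncPow β t : ℂ)) (-ξ) := by
    rw [Real.fourier_real_eq_integral_exp_smul, Real.fourier_real_eq_integral_exp_smul,
      ← integral_neg_eq_self]
    simp
  have e : 𝓕 (fun t => (rieszKernel β θ t : ℂ)) ξ =
      ((θ / Real.Gamma β : ℝ) : ℂ) * 𝓕 (fun t => (truncPow β t : ℂ)) ξ +
      (((1 - θ) / Real.Gamma β : ℝ) : ℂ) * 𝓕 (fun t => (truncPow β t : ℂ)) (-ξ) := by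
    rw [← hneg, ← smul_eq_mul, ← smul_eq_mul]
    simp_rw [Real.fourier_eq]
    rw [← integral_smul, ← integral_smul, ← integral_add]
    · congr 1
      ext t
      simp only [rieszKernel, Circle.smul_def, smul_eq_mul]
      push_cast
      ring
    · exact ((Real.fourierIntegral_convergent_iff ξ).2 hT).smul ((θ / Real.Gamma β : ℝ) : ℂ)
    · exact ((Real.fourierIntegral_convergent_iff ξ).2 hT.comp_neg).smul
        (((1 - θ) / Real.Gamma β : ℝ) : ℂ)
  rw [e]
  refine (norm_add_le _ _).trans ?_
  rw [norm_mul, norm_mul, Complex.norm_real, Complex.norm_real]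
  have h1 := norm_fourier_truncPow_le hβ hβ1 hξ
  have h2 := norm_fourier_truncPow_le hβ hβ1 (neg_ne_zero.2 hξ)
  rw [abs_neg] at h2
  calc _ ≤ _ := add_le_add (mul_le_mul_of_nonneg_left h1 (norm_nonneg _))
        (mul_le_mul_of_nonneg_left h2 (norm_nonneg _))
    _ = _ := by ring

open ContinuousLinearMap in
lemma rieszConv_eq_convolution (β θ : ℝ) (w : ℝ → ℝ) :
    rieszConv β θ w = convolution (rieszKernel β θ) w (mul ℝ ℝ) volume := rfl

open ContinuousLinearMap in
lemma rieszConv_ofReal (β θ : ℝ) (w : ℝ → ℝ) :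
    (fun x => (rieszConv β θ w x : ℂ)) =
      convolution (fun t => (rieszKernel β θ t : ℂ)) (fun t => (w t : ℂ)) (mul ℂ ℂ) volume := by
  ext x
  rw [rieszConv, convolution_def, ← integral_complex_ofReal]
  simp

lemma IsTest.contDiff_rieszConv {β : ℝ} (hβ : 0 < β) (θ : ℝ) {φ : ℝ → ℝ} (h : IsTest φ) :
    ContDiff ℝ ∞ (rieszConv β θ φ) := by
  rw [rieszConv_eq_convolution]
  exact h.2.1.contDiff_convolution_right _ (integrable_rieszKernel hβ θ).locallyIntegrable h.1

lemma IsTest.hasDerivAt_rieszConv {β : ℝ} (hβ : 0 < β) (θ : ℝ) {φ : ℝ → ℝ} (h : IsTest φ)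
    (x : ℝ) : HasDerivAt (rieszConv β θ φ) (rieszConv β θ (deriv φ) x) x := by
  rw [rieszConv_eq_convolution, rieszConv_eq_convolution]
  exact h.2.1.hasDerivAt_convolution_right _ (integrable_rieszKernel hβ θ).locallyIntegrable
    (h.1.of_le (by simp)) x

lemma hasCompactSupport_rieszKernel (β θ : ℝ) : HasCompactSupport (rieszKernel β θ) := by
  refine HasCompactSupport.intro (isCompact_Icc (a := (-1 : ℝ)) (b := 1)) fun t ht => ?_
  have h1 : t ∉ Ioo (0 : ℝ) 1 := fun h => ht ⟨by linarith [h.1], h.2.le⟩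
  have h2 : -t ∉ Ioo (0 : ℝ) 1 := fun h => ht ⟨by linarith [h.2], by linarith [h.1]⟩
  simp [rieszKernel, truncPow, indicator_of_notMem h1, indicator_of_notMem h2]

lemma IsTest.hasCompactSupport_rieszConv (β θ : ℝ) {φ : ℝ → ℝ} (h : IsTest φ) :
    HasCompactSupport (rieszConv β θ φ) := by
  rw [rieszConv_eq_convolution]
  exact (hasCompactSupport_rieszKernel β θ).convolution _ h.2.1

/-- A smooth compactly supported real function as a complex Schwartz function. -/
noncomputable def schwartzOfReal (w : ℝ → ℝ) (h1 : ContDiff ℝ ∞ w) (h2 : HasCompactSupport w) :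
    SchwartzMap ℝ ℂ :=
  HasCompactSupport.toSchwartzMap (f := fun x => (w x : ℂ)) (h2.comp_left (g := Complex.ofReal) rfl)
    (Complex.ofRealCLM.contDiff.comp h1)

lemma integral_sq_eq_integral_fourier {w : ℝ → ℝ} (h1 : ContDiff ℝ ∞ w)
    (h2 : HasCompactSupport w) :
    ∫ x, w x ^ 2 = ∫ ξ, ‖𝓕 (fun x => (w x : ℂ)) ξ‖ ^ 2 := by
  have := SchwartzMap.integral_norm_sq_fourier (schwartzOfReal w h1 h2)
  rw [SchwartzMap.fourier_coe] at this
  have e : ∀ x, ‖schwartzOfReal w h1 h2 x‖ ^ 2 = w x ^ 2 := fun x => by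
    change ‖(w x : ℂ)‖ ^ 2 = _
    simp
  simp_rw [e] at this
  exact this.symm

lemma integrable_norm_fourier_sq {w : ℝ → ℝ} (h1 : ContDiff ℝ ∞ w)
    (h2 : HasCompactSupport w) :
    Integrable (fun ξ => ‖𝓕 (fun x => (w x : ℂ)) ξ‖ ^ 2) := by
  have := (SchwartzMap.memLp (𝓕 (schwartzOfReal w h1 h2)) 2 volume).integrable_norm_pow two_ne_zero
  rw [SchwartzMap.fourier_coe] at this
  exact this

lemma IsTest.fourier_deriv {φ : ℝ → ℝ} (h : IsTest φ) (ξ : ℝ) :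
    ‖𝓕 (fun x => ((deriv φ x : ℝ) : ℂ)) ξ‖ = 2 * Real.pi * |ξ| * ‖𝓕 (fun x => (φ x : ℂ)) ξ‖ := by
  have e : deriv (fun x => (φ x : ℂ)) = fun x => ((deriv φ x : ℝ) : ℂ) := funext fun x =>
    ((h.differentiable x).hasDerivAt.ofReal_comp).deriv
  rw [← e, Real.fourier_deriv h.integrable.ofReal _ (e ▸ h.isTest_deriv.integrable.ofReal)]
  · simp [abs_of_pos Real.pi_pos]
  · exact fun x => ((h.differentiable x).hasDerivAt.ofReal_comp).differentiableAt

/-- The derivative of the fractional integral of a test function is controlled in `L²` by the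
`H^(1-β)` norm of the function. -/
lemma exists_l2Norm_rieszConv_deriv_le {β : ℝ} (hβ : 0 < β) (hβ1 : β < 1) (θ : ℝ) :
    ∃ C, 0 ≤ C ∧ ∀ φ, IsTest φ → l2Norm (rieszConv β θ (deriv φ)) ≤ C * fracNorm (1 - β) φ := by
  obtain ⟨C, hC0, hC⟩ := exists_norm_fourier_rieszKernel_le hβ hβ1 θ
  refine ⟨C, hC0, fun φ hφ => ?_⟩
  have hφ' := hφ.isTest_deriv
  have hs := hφ'.contDiff_rieszConv hβ θ
  have hc := hφ'.hasCompactSupport_rieszConv β θ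
  -- By the convolution theorem the derivative contributes `|ω|` and the kernel at most `C
  -- |ω|^(-β)`, which together give the weight of `H^{1-β}`.
  have hF : ∀ ξ : ℝ, ξ ≠ 0 → ‖𝓕 (fun x => (rieszConv β θ (deriv φ) x : ℂ)) ξ‖ ^ 2 ≤
      C ^ 2 * ((2 * Real.pi * |ξ|) ^ (1 - β) * ‖𝓕 (fun x => (φ x : ℂ)) ξ‖) ^ 2 := by
    intro ξ hξ
    have hp : 0 < 2 * Real.pi * |ξ| := by positivity
    have hcv := Real.fourier_mul_convolution_eq (f₁ := fun t => (rieszKernel β θ t : ℂ))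
      (f₂ := fun t => ((deriv φ t : ℝ) : ℂ)) (integrable_rieszKernel hβ θ).ofReal
      hφ'.integrable.ofReal ξ
    rw [rieszConv_ofReal, hcv, ← mul_pow, norm_mul, hφ.fourier_deriv]
    refine pow_le_pow_left₀ (by positivity) ?_ 2
    calc _ ≤ (C * (2 * Real.pi * |ξ|) ^ (-β)) *
          (2 * Real.pi * |ξ| * ‖𝓕 (fun x => (φ x : ℂ)) ξ‖) :=
          mul_le_mul_of_nonneg_right (hC ξ hξ) (by positivity)
      _ = _ := by
        rw [show 1 - β = -β + 1 by ring, Real.rpow_add hp, Real.rpow_one]; ring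
  have hint : Integrable (fun ξ : ℝ =>
      ((2 * Real.pi * |ξ|) ^ (1 - β) * ‖𝓕 (fun x => (φ x : ℂ)) ξ‖) ^ 2) := by
    have hcont : Continuous (𝓕 (fun x => (φ x : ℂ))) :=
      (𝓕 (schwartzOfReal φ hφ.1 hφ.2.1)).continuous
    refine (((integrable_norm_fourier_sq hφ.1 hφ.2.1).const_mul 2).add
      ((integrable_norm_fourier_sq hφ'.1 hφ'.2.1).const_mul 2)).mono' ?_ (ae_of_all _ fun ξ => ?_)
    · refine Continuous.aestronglyMeasurable ?_
      have : Continuous (fun ξ : ℝ => (2 * Real.pi * |ξ|) ^ (1 - β)) :=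
        (by fun_prop : Continuous fun ξ : ℝ => 2 * Real.pi * |ξ|).rpow_const
          fun _ => Or.inr (by linarith)
      fun_prop
    · have hp : 0 ≤ 2 * Real.pi * |ξ| := by positivity
      -- Since `0 ≤ 1 - β ≤ 1`, the fractional weight is dominated by the transforms of `φ` and
      -- `φ'`, both square integrable.
      have h1 : (2 * Real.pi * |ξ|) ^ (1 - β) ≤ 1 + 2 * Real.pi * |ξ| := by
        rcases le_total (2 * Real.pi * |ξ|) 1 with h | h
        · linarith [Real.rpow_le_one hp h (by linarith : 0 ≤ 1 - β)]
        · have := Real.rpow_le_rpow_of_exponent_le h (by linarith : 1 - β ≤ 1)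
          rw [Real.rpow_one] at this
          linarith
      have h0 : 0 ≤ (2 * Real.pi * |ξ|) ^ (1 - β) := Real.rpow_nonneg hp _
      rw [Real.norm_of_nonneg (sq_nonneg _), Pi.add_apply, hφ.fourier_deriv]
      have := mul_le_mul_of_nonneg_right h1 (norm_nonneg (𝓕 (fun x => (φ x : ℂ)) ξ))
      have h2 := pow_le_pow_left₀ (by positivity) this 2
      nlinarith [sq_nonneg (‖𝓕 (fun x => (φ x : ℂ)) ξ‖ -
        2 * Real.pi * |ξ| * ‖𝓕 (fun x => (φ x : ℂ)) ξ‖)]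
  have hmain : ∫ x, rieszConv β θ (deriv φ) x ^ 2 ≤ C ^ 2 *
      ∫ ξ : ℝ, ((2 * Real.pi * |ξ|) ^ (1 - β) * ‖𝓕 (fun x => (φ x : ℂ)) ξ‖) ^ 2 := by
    rw [integral_sq_eq_integral_fourier hs hc, ← integral_const_mul]
    refine integral_mono_ae (integrable_norm_fourier_sq hs hc) (hint.const_mul _) ?_
    filter_upwards [compl_mem_ae_iff.2 (measure_singleton (0 : ℝ))] with ξ hξ
    exact hF ξ hξ
  rw [l2Norm, fracNorm, ← Real.sqrt_sq hC0, ← Real.sqrt_mul (sq_nonneg _)]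
  refine Real.sqrt_le_sqrt ?_
  have h1 : ∫ x in Ioo (0 : ℝ) 1, rieszConv β θ (deriv φ) x ^ 2 ≤
      ∫ x, rieszConv β θ (deriv φ) x ^ 2 :=
    setIntegral_le_integral
      ((hs.continuous.memLp_of_hasCompactSupport (p := 2) hc).integrable_sq)
      (ae_of_all _ fun x => sq_nonneg _)
  have h2 : 0 ≤ ∫ x, φ x ^ 2 := integral_nonneg fun x => sq_nonneg _
  nlinarith [sq_nonneg C]

/-! ### Beta integrals and the weight -/

/-- `∫₀¹ t^p (1-t)^q dt`. -/
noncomputable def betaInt (p q : ℝ) : ℝ := ∫ t in Ioo (0 : ℝ) 1, t ^ p * (1 - t) ^ q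

lemma integrableOn_beta {p q : ℝ} (hp : -1 < p) (hq : -1 < q) :
    IntegrableOn (fun t : ℝ => t ^ p * (1 - t) ^ q) (Ioo 0 1) := by
  have h := Complex.betaIntegral_convergent (u := (p + 1 : ℝ)) (v := (q + 1 : ℝ))
    (by rw [Complex.ofReal_re]; linarith) (by rw [Complex.ofReal_re]; linarith)
  rw [intervalIntegrable_iff_integrableOn_Ioo_of_le zero_le_one] at h
  refine IntegrableOn.congr_fun (Integrable.norm h) (fun t ht => ?_) measurableSet_Ioo
  have h1 : 0 < 1 - t := by linarith [ht.2]
  have e1 : ((p + 1 : ℝ) : ℂ) - 1 = (p : ℂ) := by push_cast; ring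
  have e2 : ((q + 1 : ℝ) : ℂ) - 1 = (q : ℂ) := by push_cast; ring
  have e3 : (1 : ℂ) - t = ((1 - t : ℝ) : ℂ) := by push_cast; ring
  rw [e1, e2, e3, norm_mul, Complex.norm_cpow_eq_rpow_re_of_pos ht.1,
    Complex.norm_cpow_eq_rpow_re_of_pos h1]
  simp

lemma integrableOn_beta_mul {p q : ℝ} (hp : -1 < p) (hq : -1 < q) {h : ℝ → ℝ}
    (hh : ContinuousOn h (Icc 0 1)) :
    IntegrableOn (fun t : ℝ => t ^ p * (1 - t) ^ q * h t) (Ioo 0 1) := by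
  obtain ⟨C, hC⟩ := isCompact_Icc.exists_bound_of_continuousOn hh
  refine Integrable.mul_bdd (c := C) (integrableOn_beta hp hq)
    ((hh.mono Ioo_subset_Icc_self).aestronglyMeasurable measurableSet_Ioo) ?_
  filter_upwards [ae_restrict_mem measurableSet_Ioo] with x hx
  exact hC x (Ioo_subset_Icc_self hx)

lemma betaInt_nonneg (p q : ℝ) : 0 ≤ betaInt p q :=
  setIntegral_nonneg measurableSet_Ioo fun t ht =>
    mul_nonneg (Real.rpow_nonneg ht.1.le _) (Real.rpow_nonneg (by linarith [ht.2]) _)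

lemma continuousOn_betaInt {r q : ℝ} (hr : -1 < r) (hq : -1 < q) :
    ContinuousOn (fun p => betaInt p q) (Ici r) := by
  refine continuousOn_of_dominated (bound := fun t => t ^ r * (1 - t) ^ q)
    (fun p hp => (integrableOn_beta (lt_of_lt_of_le hr hp) hq).1) (fun p hp => ?_)
    (integrableOn_beta hr hq) ?_
  · filter_upwards [ae_restrict_mem measurableSet_Ioo] with t ht
    have h1 : 0 ≤ (1 - t) ^ q := Real.rpow_nonneg (by linarith [ht.2]) _
    rw [norm_mul, Real.norm_of_nonneg h1, Real.norm_of_nonneg (Real.rpow_nonneg ht.1.le _)]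
    exact mul_le_mul_of_nonneg_right
      (Real.rpow_le_rpow_of_exponent_ge ht.1 ht.2.le hp) h1
  · filter_upwards [ae_restrict_mem measurableSet_Ioo] with t ht
    exact ((Real.continuous_const_rpow ht.1.ne').mul continuous_const).continuousOn

/-- The balance of exponents that makes the derivative of the adjoint vanish on the weight. The
difference of the two sides is nonnegative at `b = -β` and nonpositive at `b = 0`, so the
intermediate value theorem applies. -/
lemma exists_exponent {β θ : ℝ} (hβ : 0 < β) (hβ1 : β < 1) (hθ : 0 ≤ θ) (hθ1 : θ ≤ 1) :
    ∃ b ∈ Icc (-β) 0, θ * (-β - b) * betaInt b (β - 1) =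
      (1 - θ) * b * betaInt (-β - b) (β - 1) := by
  have hc := continuousOn_betaInt (r := -β) (q := β - 1) (by linarith) (by linarith)
  have hc1 : ContinuousOn (fun b => betaInt b (β - 1)) (Icc (-β) 0) :=
    hc.mono Icc_subset_Ici_self
  have hc2 : ContinuousOn (fun b => betaInt (-β - b) (β - 1)) (Icc (-β) 0) :=
    hc.comp (by fun_prop) fun b hb => by simp only [mem_Ici]; linarith [hb.2]
  have hf : ContinuousOn (fun b => θ * (-β - b) * betaInt b (β - 1) -
      (1 - θ) * b * betaInt (-β - b) (β - 1)) (Icc (-β) 0) := by fun_prop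
  have h0 := betaInt_nonneg 0 (β - 1)
  have := intermediate_value_Icc' (by linarith : -β ≤ 0) hf
  obtain ⟨b, hb, e⟩ := this (show (0 : ℝ) ∈ _ from ⟨by
      have : 0 ≤ θ * β * betaInt 0 (β - 1) := by positivity
      simp only [mul_zero, zero_mul, sub_zero]
      linarith, by
      have : 0 ≤ (1 - θ) * β * betaInt 0 (β - 1) :=
        mul_nonneg (mul_nonneg (by linarith) hβ.le) h0
      simp only [sub_self, mul_zero, zero_mul, zero_sub]
      linarith⟩)
  exact ⟨b, hb, sub_eq_zero.1 e⟩

/-- The Möbius-invariant beta integral with singular points `0`, `1` and `c`. -/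
lemma setIntegral_mobius_beta {a b β c : ℝ} (hab : a + b = -β) (hc : 1 < c) :
    ∫ t in Ioo (0 : ℝ) 1, t ^ a * (1 - t) ^ (β - 1) * (c - t) ^ (b - 1) =
      betaInt a (β - 1) * ((c - 1) ^ (-a - 1) * c ^ (-β)) := by
  have hc1 : 0 < c - 1 := by linarith
  have hc0 : 0 < c := by linarith
  -- The Möbius map `t ↦ t(c-1)/(c-t)` fixes `0` and `1` and sends `c` to infinity. The exponents
  -- `a`, `β-1`, `b-1` sum to `-2`, so its Jacobian absorbs every power of `c - t`.
  have hd : ∀ t ∈ Ioo (0 : ℝ) 1, HasDerivWithinAt (fun t => t * (c - 1) / (c - t))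
      ((c - 1) * c / (c - t) ^ 2) (Ioo 0 1) t := fun t ht => by
    have hct : c - t ≠ 0 := by linarith [ht.2]
    have := ((hasDerivAt_id t).mul_const (c - 1)).div ((hasDerivAt_id t).const_sub c) hct
    refine (this.congr_deriv ?_).hasDerivWithinAt
    simp only [id]
    ring
  have hinj : InjOn (fun t => t * (c - 1) / (c - t)) (Ioo 0 1) := fun t ht s hs h => by
    have hct : c - t ≠ 0 := by linarith [ht.2]
    have hcs : c - s ≠ 0 := by linarith [hs.2]
    simp only at h
    rw [div_eq_div_iff hct hcs] at h
    have : (t - s) * (c * (c - 1)) = 0 := by linear_combination h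
    rcases mul_eq_zero.1 this with h1 | h1
    · linarith
    · exact absurd h1 (by positivity)
  have himg : (fun t => t * (c - 1) / (c - t)) '' Ioo 0 1 = Ioo 0 1 := by
    ext y
    constructor
    · rintro ⟨t, ht, rfl⟩
      have hct : 0 < c - t := by linarith [ht.2]
      refine ⟨div_pos (mul_pos ht.1 hc1) hct, (div_lt_one hct).2 ?_⟩
      nlinarith [ht.2]
    · rintro ⟨hy0, hy1⟩
      have hcy : 0 < c - 1 + y := by linarith
      refine ⟨c * y / (c - 1 + y), ⟨by positivity, (div_lt_one hcy).2 (by nlinarith)⟩, ?_⟩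
      have h2 : c - c * y / (c - 1 + y) = c * (c - 1) / (c - 1 + y) := by
        field_simp
        ring
      simp only [h2]
      field_simp
  have key := integral_image_eq_integral_abs_deriv_smul measurableSet_Ioo hd hinj
    (fun y => y ^ a * (1 - y) ^ (β - 1))
  rw [himg] at key
  rw [betaInt, key, ← integral_mul_const]
  refine setIntegral_congr_fun measurableSet_Ioo fun t ht => ?_
  have ht0 := ht.1
  have h1t : 0 < 1 - t := by linarith [ht.2]
  have hct : 0 < c - t := by linarith [ht.2]
  have e1 : 1 - t * (c - 1) / (c - t) = c * (1 - t) / (c - t) := by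
    field_simp
    ring
  simp only [smul_eq_mul]
  rw [e1, abs_of_pos (by positivity), Real.div_rpow (by positivity) hct.le,
    Real.div_rpow (by positivity) hct.le, Real.mul_rpow ht0.le hc1.le,
    Real.mul_rpow hc0.le h1t.le]
  have p1 : (c - 1) ^ (-a - 1) = ((c - 1) ^ a)⁻¹ * (c - 1)⁻¹ := by
    rw [Real.rpow_sub hc1, Real.rpow_neg hc1.le, Real.rpow_one, div_eq_mul_inv]
  have p2 : c ^ (-β) = (c ^ (β - 1))⁻¹ * c⁻¹ := by
    rw [← Real.rpow_neg hc0.le, ← Real.rpow_neg_one c, ← Real.rpow_add hc0]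
    ring_nf
  have p3 : (c - t) ^ (b - 1) = ((c - t) ^ a)⁻¹ * ((c - t) ^ (β - 1))⁻¹ * ((c - t) ^ 2)⁻¹ := by
    rw [← Real.rpow_neg hct.le, ← Real.rpow_neg hct.le, ← Real.rpow_natCast,
      ← Real.rpow_neg hct.le, ← Real.rpow_add hct, ← Real.rpow_add hct]
    congr 1
    push_cast
    linarith
  rw [p1, p2, p3]
  have q1 : (c - 1) ^ a ≠ 0 := (Real.rpow_pos_of_pos hc1 _).ne'
  have q2 : c ^ (β - 1) ≠ 0 := (Real.rpow_pos_of_pos hc0 _).ne'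
  field_simp

lemma hasDerivAt_integral_beta {a b β c : ℝ} (hβ : 0 < β) (ha : -1 < a)
    (hab : a + b = -β) (hc : 1 < c) :
    HasDerivAt (fun c => ∫ t in Ioo (0 : ℝ) 1, t ^ a * (1 - t) ^ (β - 1) * (c - t) ^ b)
      (b * betaInt a (β - 1) * ((c - 1) ^ (-a - 1) * c ^ (-β))) c := by
  have hβ' : -1 < β - 1 := by linarith
  have hcont : ∀ c' > 1, ∀ r : ℝ, ContinuousOn (fun t : ℝ => (c' - t) ^ r) (Icc 0 1) :=
    fun c' hc' r => ContinuousOn.rpow_const (by fun_prop) fun t ht => Or.inl (by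
      have := ht.2
      linarith)
  -- Staying to the right of the midpoint of `1` and `c` keeps `c' - t` above `(c-1)/2`; as `b < 1`,
  -- the power `b - 1` is then bounded by its value there.
  have key := hasDerivAt_integral_of_dominated_loc_of_deriv_le (𝕜 := ℝ)
    (μ := volume.restrict (Ioo (0 : ℝ) 1)) (x₀ := c) (s := Ioi ((1 + c) / 2))
    (F := fun c t => t ^ a * (1 - t) ^ (β - 1) * (c - t) ^ b)
    (F' := fun c t => t ^ a * (1 - t) ^ (β - 1) * (b * (c - t) ^ (b - 1)))
    (bound := fun t => t ^ a * (1 - t) ^ (β - 1) * (|b| * ((c - 1) / 2) ^ (b - 1)))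
    (Ioi_mem_nhds (by linarith))
    (by
      filter_upwards [Ioi_mem_nhds hc] with c' hc'
      exact (integrableOn_beta_mul ha hβ' (hcont c' hc' b)).1)
    (integrableOn_beta_mul ha hβ' (hcont c hc b))
    (integrableOn_beta_mul ha hβ' (continuousOn_const.mul (hcont c hc (b - 1)))).1
    (by
      filter_upwards [ae_restrict_mem measurableSet_Ioo] with t ht c' hc'
      have h1 : 0 < 1 - t := by linarith [ht.2]
      have h2 : (c - 1) / 2 < c' - t := by
        have := mem_Ioi.1 hc'
        linarith [ht.2]
      have h3 : 0 < (c - 1) / 2 := by linarith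
      have h4 : 0 ≤ t ^ a * (1 - t) ^ (β - 1) :=
        mul_nonneg (Real.rpow_nonneg ht.1.le _) (Real.rpow_nonneg h1.le _)
      rw [norm_mul, Real.norm_of_nonneg h4, norm_mul,
        Real.norm_of_nonneg (Real.rpow_nonneg (h3.trans h2).le _)]
      exact mul_le_mul_of_nonneg_left (mul_le_mul_of_nonneg_left
        (Real.rpow_le_rpow_of_nonpos h3 h2.le (by linarith)) (abs_nonneg _)) h4)
    ((integrableOn_beta ha hβ').mul_const _)
    (by
      filter_upwards [ae_restrict_mem measurableSet_Ioo] with t ht c' hc'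
      have h2 : c' - t ≠ 0 := by
        have := mem_Ioi.1 hc'
        have := ht.2
        linarith
      have := (((hasDerivAt_id c').sub_const t).rpow_const (p := b) (Or.inl h2)).const_mul
        (t ^ a * (1 - t) ^ (β - 1))
      simpa using this)
  refine key.2.congr_deriv ?_
  rw [mul_assoc, ← setIntegral_mobius_beta hab hc, ← integral_const_mul]
  congr 1
  ext t
  ring

/-- The one-sided fractional integral (up to a factor) of the weight `x^a (1-x)^b`. -/
noncomputable def weightInt (β a b s : ℝ) : ℝ :=
  ∫ x in Ioo (0 : ℝ) 1, truncPow β (s - x) * (x ^ a * (1 - x) ^ b)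

/-- The substitution `x = s t` with `1 - s t = s (s⁻¹ - t)`. The total power of `s` is `β - 1 + a +
b = -1`, exactly what the Jacobian cancels, so that `s` survives only through `c = s⁻¹`. -/
lemma indicator_weight_scaled {β a b s : ℝ} (hab : a + b = -β)
    (hs : s ∈ Ioo (0 : ℝ) 1) (t : ℝ) :
    (Ioo (0 : ℝ) 1).indicator (fun x => truncPow β (s - x) * (x ^ a * (1 - x) ^ b)) (s * t) =
    s⁻¹ * (Ioo (0 : ℝ) 1).indicator
      (fun t => t ^ a * (1 - t) ^ (β - 1) * (s⁻¹ - t) ^ b) t := by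
  have hs0 := hs.1
  by_cases ht : t ∈ Ioo (0 : ℝ) 1
  · have h1t : 0 < 1 - t := by linarith [ht.2]
    have hst : s * t < s := by nlinarith [ht.2]
    have hst0 : 0 < s * t := mul_pos hs0 ht.1
    rw [indicator_of_mem ht, indicator_of_mem (show s * t ∈ Ioo (0 : ℝ) 1 from
      ⟨hst0, by linarith [hs.2]⟩), truncPow, indicator_of_mem
      (show s - s * t ∈ Ioo (0 : ℝ) 1 from ⟨by linarith, by linarith [hs.2]⟩)]
    have e1 : s - s * t = s * (1 - t) := by ring
    have e2 : 1 - s * t = s * (s⁻¹ - t) := by field_simp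
    have h2 : 0 < s⁻¹ - t := by
      have := (one_lt_inv₀ hs0).2 hs.2
      linarith [ht.2]
    rw [e1, e2, Real.mul_rpow hs0.le h1t.le, Real.mul_rpow hs0.le ht.1.le,
      Real.mul_rpow hs0.le h2.le]
    have p : s ^ (β - 1) * s ^ a * s ^ b = s⁻¹ := by
      rw [← Real.rpow_add hs0, ← Real.rpow_add hs0, ← Real.rpow_neg_one]
      congr 1
      linarith
    rw [← p]
    ring
  · rw [indicator_of_notMem ht, mul_zero]
    by_cases h : s * t ∈ Ioo (0 : ℝ) 1
    · rw [indicator_of_mem h, truncPow, indicator_of_notMem, zero_mul]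
      intro h'
      have : 0 < t := pos_of_mul_pos_right h.1 hs0.le
      exact ht ⟨this, by nlinarith [h'.1]⟩
    · rw [indicator_of_notMem h]

lemma continuousOn_inv_sub_rpow {s : ℝ} (hs : s ∈ Ioo (0 : ℝ) 1) (b : ℝ) :
    ContinuousOn (fun t : ℝ => (s⁻¹ - t) ^ b) (Icc 0 1) :=
  ContinuousOn.rpow_const (by fun_prop) fun t ht => Or.inl (by
    have := ht.2
    have := (one_lt_inv₀ hs.1).2 hs.2
    linarith)

lemma integrableOn_weight {β a b s : ℝ} (hβ : 0 < β) (ha : -1 < a) (hab : a + b = -β)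
    (hs : s ∈ Ioo (0 : ℝ) 1) :
    IntegrableOn (fun x => truncPow β (s - x) * (x ^ a * (1 - x) ^ b)) (Ioo 0 1) := by
  rw [← integrable_indicator_iff measurableSet_Ioo, ← integrable_comp_mul_left_iff _ hs.1.ne']
  simp_rw [indicator_weight_scaled hab hs]
  exact ((integrableOn_beta_mul ha (by linarith)
    (continuousOn_inv_sub_rpow hs b)).integrable_indicator measurableSet_Ioo).const_mul _

lemma weightInt_eq {β a b s : ℝ} (hab : a + b = -β) (hs : s ∈ Ioo (0 : ℝ) 1) :
    weightInt β a b s = ∫ t in Ioo (0 : ℝ) 1, t ^ a * (1 - t) ^ (β - 1) * (s⁻¹ - t) ^ b := by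
  have h := Measure.integral_comp_mul_left ((Ioo (0 : ℝ) 1).indicator
    (fun x => truncPow β (s - x) * (x ^ a * (1 - x) ^ b))) s
  simp_rw [indicator_weight_scaled hab hs] at h
  rw [integral_const_mul, integral_indicator measurableSet_Ioo,
    integral_indicator measurableSet_Ioo, abs_of_pos (inv_pos.2 hs.1), smul_eq_mul] at h
  exact (mul_left_cancel₀ (inv_pos.2 hs.1).ne' h).symm

/-- Differentiating in `c = s⁻¹` brings the exponent down to `b - 1`, where the Möbius-invariant
integral is explicit. The resulting profile `s^(-b-1) (1-s)^(-a-1)` is unchanged when `a`, `b` and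
`s`, `1-s` are swapped together, so the left and right contributions can cancel. -/
lemma hasDerivAt_weightInt {β a b s : ℝ} (hβ : 0 < β) (ha : -1 < a)
    (hab : a + b = -β) (hs : s ∈ Ioo (0 : ℝ) 1) :
    HasDerivAt (weightInt β a b)
      (-b * betaInt a (β - 1) * (s ^ (-b - 1) * (1 - s) ^ (-a - 1))) s := by
  have hs0 := hs.1
  have h1s : 0 < 1 - s := by linarith [hs.2]
  have hc := (one_lt_inv₀ hs.1).2 hs.2
  have h1 := (hasDerivAt_integral_beta hβ ha hab hc).comp s (hasDerivAt_inv hs.1.ne')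
  have h2 : weightInt β a b =ᶠ[𝓝 s]
      ((fun c => ∫ t in Ioo (0 : ℝ) 1, t ^ a * (1 - t) ^ (β - 1) * (c - t) ^ b) ∘ fun x => x⁻¹) := by
    filter_upwards [Ioo_mem_nhds hs.1 hs.2] with s' hs'
    exact weightInt_eq hab hs'
  refine (h1.congr_of_eventuallyEq h2).congr_deriv ?_
  have e1 : s⁻¹ - 1 = (1 - s) * s⁻¹ := by field_simp
  rw [e1, Real.mul_rpow h1s.le (inv_pos.2 hs0).le, Real.inv_rpow hs0.le, Real.inv_rpow hs0.le,
    ← Real.rpow_neg hs0.le, ← Real.rpow_neg hs0.le]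
  have p : s ^ (-b - 1) = s ^ (-(-a - 1)) * s ^ (- -β) * (s ^ 2)⁻¹ := by
    rw [← Real.rpow_natCast, ← Real.rpow_neg hs0.le, ← Real.rpow_add hs0, ← Real.rpow_add hs0]
    congr 1
    push_cast
    linarith
  rw [p]
  ring

lemma setIntegral_reflect (g : ℝ → ℝ) :
    ∫ x in Ioo (0 : ℝ) 1, g (1 - x) = ∫ x in Ioo (0 : ℝ) 1, g x := by
  rw [setIntegral_Ioo_eq, setIntegral_Ioo_eq, intervalIntegral.integral_comp_sub_left]
  simp

lemma integrableOn_reflect {g : ℝ → ℝ} (h : IntegrableOn g (Ioo 0 1)) :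
    IntegrableOn (fun x => g (1 - x)) (Ioo 0 1) := by
  rw [← intervalIntegrable_iff_integrableOn_Ioo_of_le zero_le_one] at h ⊢
  simpa using (h.comp_sub_left 1).symm

/-- A positive weight on which the adjoint of `I^β_θ` is constant. -/
theorem exists_weight {β θ : ℝ} (hβ : 0 < β) (hβ' : β < 1 / 2) (hθ : 0 ≤ θ) (hθ1 : θ ≤ 1) :
    ∃ ρ : ℝ → ℝ, MemLp ρ 2 vol01 ∧ (∀ x ∈ Ioo (0 : ℝ) 1, 0 < ρ x) ∧
      ∃ c : ℝ, ∀ s ∈ Ioo (0 : ℝ) 1, ∫ x in Ioo (0 : ℝ) 1, rieszKernel β θ (x - s) * ρ x = c := by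
  obtain ⟨b, hb, e⟩ := exists_exponent hβ (by linarith) hθ hθ1
  obtain ⟨a, ha⟩ : ∃ a, a = -β - b := ⟨_, rfl⟩
  rw [← ha] at e
  have hab : a + b = -β := by rw [ha]; ring
  have hb0 := hb.1
  have hb1 := hb.2
  have ha0 : -β ≤ a := by linarith
  have ha1 : a ≤ 0 := by linarith
  refine ⟨fun x => x ^ a * (1 - x) ^ b, ?_, fun x hx => mul_pos (Real.rpow_pos_of_pos hx.1 _)
    (Real.rpow_pos_of_pos (by linarith [hx.2]) _), ?_⟩
  · refine (memLp_two_iff_integrable_sq ?_).2 ?_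
    · exact (integrableOn_beta (by linarith) (by linarith)).1
    -- Both exponents are at least `-β`, so after squaring they exceed `-1`; this is where `β < 1/2`
    -- enters.
    · refine (integrableOn_beta (p := a * 2) (q := b * 2) (by linarith) (by linarith)).congr_fun
        (fun x hx => ?_) measurableSet_Ioo
      have h1 : 0 ≤ 1 - x := by linarith [hx.2]
      simp only
      rw [Real.rpow_mul hx.1.le, Real.rpow_mul h1, mul_pow]
      norm_cast
  set Ψ : ℝ → ℝ := fun s => θ / Real.Gamma β * weightInt β b a (1 - s) +
    (1 - θ) / Real.Gamma β * weightInt β a b s with hΨ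
  have hder : ∀ s ∈ Ioo (0 : ℝ) 1, HasDerivAt Ψ 0 s := by
    intro s hs
    have hs' : 1 - s ∈ Ioo (0 : ℝ) 1 := ⟨by linarith [hs.2], by linarith [hs.1]⟩
    have h1 := (hasDerivAt_weightInt hβ (by linarith) (by linarith : b + a = -β) hs').comp s
      ((hasDerivAt_id s).const_sub 1)
    have h2 := hasDerivAt_weightInt hβ (by linarith) hab hs
    refine ((h1.const_mul (θ / Real.Gamma β)).add
      (h2.const_mul ((1 - θ) / Real.Gamma β))).congr_deriv ?_
    rw [sub_sub_cancel]
    -- After the common profile is factored out, the choice of `b` is what remains.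
    linear_combination (s ^ (-b - 1) * (1 - s) ^ (-a - 1) / Real.Gamma β) * e
  have hmid : (1 / 2 : ℝ) ∈ Ioo (0 : ℝ) 1 := by constructor <;> norm_num
  refine ⟨Ψ (1 / 2), fun s hs => ?_⟩
  have hconst : Ψ s = Ψ (1 / 2) := isOpen_Ioo.is_const_of_deriv_eq_zero isPreconnected_Ioo
    (fun s hs => (hder s hs).differentiableAt.differentiableWithinAt)
    (fun s hs => (hder s hs).deriv) hs hmid
  rw [← hconst, hΨ]
  have hs' : 1 - s ∈ Ioo (0 : ℝ) 1 := ⟨by linarith [hs.2], by linarith [hs.1]⟩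
  have hi1 := integrableOn_weight hβ (by linarith) hab hs
  have hi2 := integrableOn_weight hβ (by linarith) (by linarith : b + a = -β) hs'
  -- The reflection `x ↦ 1 - x` turns the other one-sided integral into `weightInt` with the
  -- exponents exchanged.
  have hr : ∀ x, truncPow β (x - s) * (x ^ a * (1 - x) ^ b) =
      truncPow β (1 - s - (1 - x)) * ((1 - x) ^ b * (1 - (1 - x)) ^ a) := fun x => by
    rw [sub_sub_cancel, mul_comm ((1 - x) ^ b)]
    congr 2
    ring
  have hi3 : IntegrableOn (fun x => truncPow β (x - s) * (x ^ a * (1 - x) ^ b)) (Ioo 0 1) := by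
    simp_rw [hr]
    exact integrableOn_reflect hi2
  have he : ∫ x in Ioo (0 : ℝ) 1, truncPow β (x - s) * (x ^ a * (1 - x) ^ b) =
      weightInt β b a (1 - s) := by
    simp_rw [hr]
    exact setIntegral_reflect (fun x => truncPow β (1 - s - x) * (x ^ b * (1 - x) ^ a))
  simp only
  rw [← he, weightInt, ← integral_const_mul, ← integral_const_mul, ← integral_add
    (hi3.const_mul _) (hi1.const_mul _)]
  congr 1
  ext x
  rw [rieszKernel, neg_sub]
  ring

/-! ### `I^β_θ` as a convolution -/

lemma rieszConv_eq_swap (β θ : ℝ) (w : ℝ → ℝ) (x : ℝ) :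
    rieszConv β θ w x = ∫ s, rieszKernel β θ (x - s) * w s := by
  rw [rieszConv, ← integral_sub_left_eq_self _ volume x]
  simp

lemma rieszKernel_of_pos {β θ t : ℝ} (ht : t ∈ Ioo (0 : ℝ) 1) :
    rieszKernel β θ t = θ / Real.Gamma β * t ^ (β - 1) := by
  have h2 : -t ∉ Ioo (0 : ℝ) 1 := fun h => by linarith [h.1, ht.1]
  simp [rieszKernel, truncPow, indicator_of_mem ht, indicator_of_notMem h2]

lemma rieszKernel_of_neg {β θ t : ℝ} (ht : -t ∈ Ioo (0 : ℝ) 1) :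
    rieszKernel β θ t = (1 - θ) / Real.Gamma β * (-t) ^ (β - 1) := by
  have h2 : t ∉ Ioo (0 : ℝ) 1 := fun h => by linarith [h.1, ht.1]
  simp only [rieszKernel, truncPow, indicator_of_mem ht, indicator_of_notMem h2]
  simp

/-- For `x, s` in `(0,1)` the difference `x - s` lies in `(-1,1)`, so truncating the kernel loses
nothing. Integrability permits the split at `s = x`; for `w ∈ L²` it is available for almost every
`x`. -/
lemma iTheta_eq_rieszConv {β θ x : ℝ} {w : ℝ → ℝ} (hx : x ∈ Ioo (0 : ℝ) 1)
    (hi : Integrable fun s => rieszKernel β θ (x - s) * (Ioo (0 : ℝ) 1).indicator w s) :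
    iTheta β θ w x = rieszConv β θ ((Ioo (0 : ℝ) 1).indicator w) x := by
  rw [rieszConv_eq_swap, ← integral_add_compl measurableSet_Iic hi, compl_Iic, iTheta]
  congr 1
  · rw [leftI, intervalIntegral.integral_of_le hx.1.le, ← mul_assoc, ← integral_const_mul,
      integral_Iic_eq_integral_Iio, integral_Ioc_eq_integral_Ioo,
      ← integral_indicator measurableSet_Iio, ← integral_indicator measurableSet_Ioo]
    congr 1
    ext s
    by_cases hs : s ∈ Ioo 0 x
    · have hs1 : s ∈ Ioo (0 : ℝ) 1 := ⟨hs.1, hs.2.trans hx.2⟩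
      rw [indicator_of_mem hs, indicator_of_mem (mem_Iio.2 hs.2), indicator_of_mem hs1,
        rieszKernel_of_pos ⟨by linarith [hs.2], by linarith [hs.1, hx.2]⟩,
        show β - 1 = -(1 - β) by ring, Real.rpow_neg (by linarith [hs.2])]
      ring
    · rw [indicator_of_notMem hs]
      by_cases h : s ∈ Iio x
      · have hs1 : s ∉ Ioo (0 : ℝ) 1 := fun h1 => hs ⟨h1.1, h⟩
        rw [indicator_of_mem h, indicator_of_notMem hs1, mul_zero]
      · rw [indicator_of_notMem h]
  · rw [rightI, intervalIntegral.integral_of_le hx.2.le, ← mul_assoc, ← integral_const_mul,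
      integral_Ioc_eq_integral_Ioo,
      ← integral_indicator measurableSet_Ioi, ← integral_indicator measurableSet_Ioo]
    congr 1
    ext s
    by_cases hs : s ∈ Ioo x 1
    · have hs1 : s ∈ Ioo (0 : ℝ) 1 := ⟨hx.1.trans hs.1, hs.2⟩
      rw [indicator_of_mem hs, indicator_of_mem (mem_Ioi.2 hs.1), indicator_of_mem hs1,
        rieszKernel_of_neg ⟨by linarith [hs.1], by linarith [hs.2, hx.1]⟩, neg_sub,
        show β - 1 = -(1 - β) by ring, Real.rpow_neg (by linarith [hs.1])]
      ring
    · rw [indicator_of_notMem hs]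
      by_cases h : s ∈ Ioi x
      · have hs1 : s ∉ Ioo (0 : ℝ) 1 := fun h1 => hs ⟨h, h1.2⟩
        rw [indicator_of_mem h, indicator_of_notMem hs1, mul_zero]
      · rw [indicator_of_notMem h]

lemma ae_integrable_rieszKernel_mul {β : ℝ} (hβ : 0 < β) (θ : ℝ) {w : ℝ → ℝ} (hw : Integrable w) :
    ∀ᵐ x, Integrable fun s => rieszKernel β θ (x - s) * w s := by
  have := Integrable.ae_convolution_exists (ContinuousLinearMap.mul ℝ ℝ)
    (integrable_rieszKernel hβ θ) hw
  filter_upwards [this] with x hx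
  exact hx.integrable_swap

/-- Young's inequality in `L¹`, from the convolution of the absolute values. -/
lemma integral_abs_rieszConv_le {β : ℝ} (hβ : 0 < β) (θ : ℝ) {w : ℝ → ℝ} (hw : Integrable w) :
    Integrable (rieszConv β θ w) ∧
      ∫ x, |rieszConv β θ w x| ≤ (∫ t, |rieszKernel β θ t|) * ∫ x, |w x| := by
  have hk := integrable_rieszKernel hβ θ
  have h1 : Integrable (rieszConv β θ w) := by
    rw [rieszConv_eq_convolution]
    exact hk.integrable_convolution _ hw
  refine ⟨h1, ?_⟩
  have h2 := integral_convolution (ContinuousLinearMap.mul ℝ ℝ) (μ := volume) (ν := volume)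
    hk.abs hw.abs
  rw [ContinuousLinearMap.mul_apply'] at h2
  rw [← h2]
  refine integral_mono h1.abs (hk.abs.integrable_convolution _ hw.abs) fun x => ?_
  rw [convolution_def]
  refine abs_integral_le_integral_abs.trans (le_of_eq ?_)
  simp [abs_mul]

lemma integral_abs_rieszConv_sub_iTheta_le {β : ℝ} (hβ : 0 < β) (θ : ℝ) {u φ : ℝ → ℝ}
    (hu : MemLp u 2 vol01) (hφ : IsTest φ) :
    IntegrableOn (iTheta β θ u) (Ioo 0 1) ∧
      ∫ x in Ioo (0 : ℝ) 1, |rieszConv β θ φ x - iTheta β θ u x| ≤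
        (∫ t, |rieszKernel β θ t|) * l2Norm (fun x => φ x - u x) := by
  have hU : Integrable ((Ioo (0 : ℝ) 1).indicator u) :=
    (MemLp.integrableOn_Ioo hu).integrable_indicator measurableSet_Ioo
  have hae : ∀ᵐ x ∂vol01, iTheta β θ u x = rieszConv β θ ((Ioo (0 : ℝ) 1).indicator u) x := by
    refine (ae_restrict_iff' measurableSet_Ioo).2 ?_
    filter_upwards [ae_integrable_rieszKernel_mul hβ θ hU] with x hx hx1
    exact iTheta_eq_rieszConv hx1 hx
  have hW := hφ.integrable.sub hU
  have hsub : ∀ᵐ x, rieszConv β θ (φ - (Ioo (0 : ℝ) 1).indicator u) x =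
      rieszConv β θ φ x - rieszConv β θ ((Ioo (0 : ℝ) 1).indicator u) x := by
    filter_upwards [ae_integrable_rieszKernel_mul hβ θ hU,
      ae_integrable_rieszKernel_mul hβ θ hφ.integrable] with x h1 h2
    rw [rieszConv_eq_swap, rieszConv_eq_swap, rieszConv_eq_swap, ← integral_sub h2 h1]
    simp [mul_sub]
  obtain ⟨hI, hle⟩ := integral_abs_rieszConv_le hβ θ hW
  refine ⟨(integral_abs_rieszConv_le hβ θ hU).1.integrableOn.congr_fun_ae
    (EventuallyEq.symm hae), ?_⟩
  have e1 : ∫ x in Ioo (0 : ℝ) 1, |rieszConv β θ φ x - iTheta β θ u x| =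
      ∫ x in Ioo (0 : ℝ) 1, |rieszConv β θ (φ - (Ioo (0 : ℝ) 1).indicator u) x| :=
    integral_congr_ae (by
      filter_upwards [hae, ae_restrict_of_ae hsub] with x h1 h2
      rw [h1, h2])
  have e2 : ∫ x, |(φ - (Ioo (0 : ℝ) 1).indicator u) x| = ∫ x in Ioo (0 : ℝ) 1, |φ x - u x| := by
    rw [← integral_indicator measurableSet_Ioo]
    congr 1
    ext x
    by_cases hx : x ∈ Ioo (0 : ℝ) 1
    · simp [indicator_of_mem hx]
    · simp [indicator_of_notMem hx, hφ.eq_zero hx]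
  rw [e1]
  refine (setIntegral_le_integral hI.abs (ae_of_all _ fun x => abs_nonneg _)).trans (hle.trans ?_)
  rw [e2]
  refine mul_le_mul_of_nonneg_left (integral_abs_le_l2Norm (w := fun x => φ x - u x) ?_)
    (integral_nonneg fun x => abs_nonneg _)
  exact ((hφ.continuous.memLp_of_hasCompactSupport hφ.2.1).restrict _).sub hu

/-! ### Moment identities for test functions -/

/-- Pairing with a weight on which the adjoint of `I^β_θ` is constant. -/
lemma IsTest.integral_rieszConv_mul {β : ℝ} (hβ : 0 < β) {θ c : ℝ} {φ ρ : ℝ → ℝ} (h : IsTest φ)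
    (hρ : MemLp ρ 2 vol01)
    (hc : ∀ s ∈ Ioo (0 : ℝ) 1, ∫ x in Ioo (0 : ℝ) 1, rieszKernel β θ (x - s) * ρ x = c) :
    ∫ x in Ioo (0 : ℝ) 1, rieszConv β θ φ x * ρ x = c * ∫ s, φ s := by
  have hR : Integrable ((Ioo (0 : ℝ) 1).indicator ρ) :=
    (MemLp.integrableOn_Ioo hρ).integrable_indicator measurableSet_Ioo
  have h1 := Integrable.convolution_integrand (ContinuousLinearMap.mul ℝ ℝ) hR
    (integrable_rieszKernel hβ θ).comp_neg
  obtain ⟨C, hC⟩ := h.2.1.exists_bound_of_continuous h.continuous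
  have h2 : Integrable (fun p : ℝ × ℝ => (Ioo (0 : ℝ) 1).indicator ρ p.2 *
      rieszKernel β θ (p.2 - p.1) * φ p.1) (volume.prod volume) := by
    refine Integrable.mul_bdd (c := C) ?_ (h.continuous.comp continuous_fst).aestronglyMeasurable
      (ae_of_all _ fun p => hC p.1)
    simpa using h1
  have e1 : ∫ x in Ioo (0 : ℝ) 1, rieszConv β θ φ x * ρ x =
      ∫ x, ∫ s, (Ioo (0 : ℝ) 1).indicator ρ x * rieszKernel β θ (x - s) * φ s := by
    rw [← integral_indicator measurableSet_Ioo]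
    congr 1
    ext x
    simp_rw [mul_assoc]
    rw [integral_const_mul, ← rieszConv_eq_swap]
    by_cases hx : x ∈ Ioo (0 : ℝ) 1
    · rw [indicator_of_mem hx, indicator_of_mem hx, mul_comm]
    · rw [indicator_of_notMem hx, indicator_of_notMem hx, zero_mul]
  rw [e1, ← integral_integral_swap (f := fun s x => (Ioo (0 : ℝ) 1).indicator ρ x *
    rieszKernel β θ (x - s) * φ s) h2, ← integral_const_mul]
  congr 1
  ext s
  rw [integral_mul_const]
  by_cases hs : s ∈ Ioo (0 : ℝ) 1
  · rw [← hc s hs, ← integral_indicator measurableSet_Ioo]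
    congr 2
    ext x
    by_cases hx : x ∈ Ioo (0 : ℝ) 1
    · rw [indicator_of_mem hx, indicator_of_mem hx, mul_comm]
    · rw [indicator_of_notMem hx, indicator_of_notMem hx, zero_mul]
  · rw [h.eq_zero hs, mul_zero, mul_zero]

lemma integral_truncPow_mul (β : ℝ) (f : ℝ → ℝ) :
    ∫ t, truncPow β t * f t = ∫ t in (0 : ℝ)..1, t ^ (β - 1) * f t := by
  rw [← setIntegral_Ioo_eq, ← integral_indicator measurableSet_Ioo]
  congr 1
  ext t
  rw [truncPow]
  exact (indicator_mul_left _ _ _).symm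

/-- The integral of `(t^β ψ)'` over `(0,1)` vanishes: `β > 0` handles `t = 0` and `ψ 1 = 0` handles
`t = 1`. -/
lemma integral_truncPow_euler {β : ℝ} (hβ : 0 < β) {ψ : ℝ → ℝ} (hψ : ContDiff ℝ 1 ψ)
    (h1 : ψ 1 = 0) :
    ∫ t, truncPow β t * (t * deriv ψ t) = -β * ∫ t, truncPow β t * ψ t := by
  have hψ' : Continuous (deriv ψ) := hψ.continuous_deriv le_rfl
  have hr : IntervalIntegrable (fun t : ℝ => t ^ (β - 1)) volume 0 1 :=
    intervalIntegral.intervalIntegrable_rpow' (by linarith)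
  have i1 : IntervalIntegrable (fun t : ℝ => t ^ (β - 1) * (t * deriv ψ t)) volume 0 1 :=
    hr.mul_continuousOn (by fun_prop)
  have i2 : IntervalIntegrable (fun t : ℝ => t ^ (β - 1) * ψ t) volume 0 1 :=
    hr.mul_continuousOn hψ.continuous.continuousOn
  have key := intervalIntegral.integral_eq_sub_of_hasDerivAt_of_le zero_le_one
    (f := fun t => t ^ β * ψ t)
    (f' := fun t => t ^ (β - 1) * (t * deriv ψ t) + β * (t ^ (β - 1) * ψ t))
    (((Real.continuous_rpow_const hβ.le).mul hψ.continuous).continuousOn)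
    (fun t ht => by
      have := (Real.hasDerivAt_rpow_const (p := β) (Or.inl ht.1.ne')).mul
        ((hψ.differentiable one_ne_zero) t).hasDerivAt
      refine this.congr_deriv ?_
      have : t ^ β = t ^ (β - 1) * t := by
        rw [← Real.rpow_add_one ht.1.ne', sub_add_cancel]
      rw [this]
      ring)
    (i1.add (i2.const_mul β))
  rw [intervalIntegral.integral_add i1 (i2.const_mul β), intervalIntegral.integral_const_mul,
    h1, Real.zero_rpow hβ.ne'] at key
  rw [integral_truncPow_mul, integral_truncPow_mul]
  linarith

lemma integrable_rieszKernel_mul_continuous {β : ℝ} (hβ : 0 < β) (θ : ℝ) {f : ℝ → ℝ}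
    (hf : Continuous f) : Integrable fun t => rieszKernel β θ t * f t := by
  have h := hasCompactSupport_rieszKernel β θ
  have h1 : IntegrableOn (fun t => rieszKernel β θ t * f t) (tsupport (rieszKernel β θ)) :=
    (integrable_rieszKernel hβ θ).integrableOn.mul_continuousOn hf.continuousOn h
  refine (integrableOn_iff_integrable_of_support_subset fun t ht => ?_).1 h1
  exact subset_tsupport _ (left_ne_zero_of_mul ht)

lemma integrable_truncPow_mul_continuous {β : ℝ} (hβ : 0 < β) {f : ℝ → ℝ}
    (hf : Continuous f) : Integrable fun t => truncPow β t * f t := by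
  have hr : IntervalIntegrable (fun t : ℝ => t ^ (β - 1)) volume 0 1 :=
    intervalIntegral.intervalIntegrable_rpow' (by linarith)
  have h1 := hr.mul_continuousOn (g := f) hf.continuousOn
  rw [intervalIntegrable_iff_integrableOn_Ioo_of_le zero_le_one] at h1
  refine (h1.integrable_indicator measurableSet_Ioo).congr (ae_of_all _ fun t => ?_)
  exact indicator_mul_left _ _ _

lemma rieszKernel_split {β : ℝ} (hβ : 0 < β) (θ : ℝ) {f : ℝ → ℝ} (hf : Continuous f) :
    ∫ t, rieszKernel β θ t * f t = θ / Real.Gamma β * (∫ t, truncPow β t * f t) +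
      (1 - θ) / Real.Gamma β * ∫ t, truncPow β t * f (-t) := by
  have i1 := integrable_truncPow_mul_continuous hβ hf
  have i2 := integrable_truncPow_mul_continuous hβ (hf.comp continuous_neg)
  have i3 : Integrable fun t => truncPow β (-t) * f t := by simpa using i2.comp_neg
  rw [← integral_neg_eq_self (fun t => truncPow β t * f (-t))]
  simp only [neg_neg]
  rw [← integral_const_mul, ← integral_const_mul, ← integral_add (i1.const_mul _)
    (i3.const_mul _)]
  congr 1
  ext t
  rw [rieszKernel]
  ring

lemma IsTest.mul_deriv {φ : ℝ → ℝ} (h : IsTest φ) : IsTest (fun s => s * deriv φ s) :=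
  ⟨contDiff_id.mul h.isTest_deriv.1, h.isTest_deriv.2.1.mul_left,
    (tsupport_mul_subset_right).trans h.isTest_deriv.2.2⟩

/-- Commutator of `I^β_θ` with the Euler operator `s d/ds`. -/
lemma IsTest.rieszConv_mul_deriv {β : ℝ} (hβ : 0 < β) (θ : ℝ) {φ : ℝ → ℝ} (h : IsTest φ)
    {x : ℝ} (hx : x ∈ Ioo (0 : ℝ) 1) :
    rieszConv β θ (fun s => s * deriv φ s) x =
      x * rieszConv β θ (deriv φ) x - β * rieszConv β θ φ x := by
  have hc := h.continuous
  have hc' := h.isTest_deriv.continuous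
  have hC1 : ContDiff ℝ 1 φ := h.1.of_le (by simp)
  have d1 : ∀ t, deriv (fun t => φ (x - t)) t = - deriv φ (x - t) := fun t =>
    deriv_comp_const_sub ..
  have d2 : ∀ t, deriv (fun t => φ (x + t)) t = deriv φ (x + t) := fun t =>
    deriv_comp_const_add ..
  have E1 := integral_truncPow_euler hβ (ψ := fun t => φ (x - t))
    (hC1.comp (contDiff_const.sub contDiff_id))
    (h.eq_zero fun hh => by linarith [hh.1, hx.2])
  have E2 := integral_truncPow_euler hβ (ψ := fun t => φ (x + t))
    (hC1.comp (contDiff_const.add contDiff_id))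
    (h.eq_zero fun hh => by linarith [hh.2, hx.1])
  simp_rw [d1] at E1
  simp_rw [d2] at E2
  -- Writing `s = x - t` in `s φ'(s)` leaves the term `t φ'(x - t)`; homogeneity of the kernel on
  -- each side of `0` turns it into `β I φ`.
  have hT : ∫ t, rieszKernel β θ t * (t * deriv φ (x - t)) = β * rieszConv β θ φ x := by
    rw [rieszConv, rieszKernel_split hβ θ (by fun_prop), rieszKernel_split hβ θ (by fun_prop)]
    simp only [sub_neg_eq_add, neg_mul, mul_neg, integral_neg] at E1 E2 ⊢
    rw [E2, neg_inj.1 E1]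
    ring
  rw [← hT, rieszConv, rieszConv, ← integral_const_mul, ← integral_sub]
  · congr 1
    ext t
    ring
  · exact (integrable_rieszKernel_mul_continuous hβ θ (by fun_prop)).const_mul _
  · exact integrable_rieszKernel_mul_continuous hβ θ (by fun_prop)

lemma IsTest.integral_deriv_eq_zero {φ : ℝ → ℝ} (h : IsTest φ) : ∫ s, deriv φ s = 0 := by
  rw [← h.isTest_deriv.setIntegral_eq', setIntegral_Ioo_eq,
    intervalIntegral.integral_deriv_eq_sub (fun x _ => h.differentiable x)
      (h.isTest_deriv.continuous.intervalIntegrable _ _),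
    h.eq_zero (x := 0) (by simp), h.eq_zero (x := 1) (by simp), sub_zero]

lemma IsTest.integral_mul_deriv {φ : ℝ → ℝ} (h : IsTest φ) :
    ∫ s, s * deriv φ s = - ∫ s, φ s := by
  have := integral_mul_deriv_eq_deriv_mul_of_integrable (u := fun s : ℝ => s) (u' := fun _ => 1)
    (v := φ) (v' := deriv φ) (fun x _ => hasDerivAt_id x)
    (fun x _ => (h.differentiable x).hasDerivAt) h.mul_deriv.integrable
    (by simpa [Pi.mul_def] using h.integrable)
    ((continuous_id.mul h.continuous).integrable_of_hasCompactSupport h.2.1.mul_left)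
  simpa using this

lemma IsTest.integral_rieszConv_deriv_mul {β : ℝ} (hβ : 0 < β) {θ c : ℝ} {φ ρ : ℝ → ℝ}
    (h : IsTest φ) (hρ : MemLp ρ 2 vol01)
    (hc : ∀ s ∈ Ioo (0 : ℝ) 1, ∫ x in Ioo (0 : ℝ) 1, rieszKernel β θ (x - s) * ρ x = c) :
    ∫ x in Ioo (0 : ℝ) 1, rieszConv β θ (deriv φ) x * ρ x = 0 := by
  rw [h.isTest_deriv.integral_rieszConv_mul hβ hρ hc, h.integral_deriv_eq_zero, mul_zero]

lemma IsTest.integrableOn_rieszConv_mul {β : ℝ} (hβ : 0 < β) (θ : ℝ) {φ ρ : ℝ → ℝ}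
    (h : IsTest φ) (hρ : MemLp ρ 2 vol01) :
    IntegrableOn (fun x => rieszConv β θ φ x * ρ x) (Ioo 0 1) := by
  obtain ⟨C, -, hC, hm⟩ := exists_bound_of_continuousOn
    (h.contDiff_rieszConv hβ θ).continuous.continuousOn
  exact MemLp.integrableOn_Ioo (MemLp.bdd_mul_vol01 hρ hm hC)

/-- Pairing `I(s φ')` with `ρ` gives `c ∫ s φ' = -c ∫ φ = -∫ (I φ) ρ`; the commutator formula
evaluates the same pairing, and `c` drops out. -/
lemma IsTest.integral_rieszConv_euler {β : ℝ} (hβ : 0 < β) {θ c : ℝ} {φ ρ : ℝ → ℝ}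
    (h : IsTest φ) (hρ : MemLp ρ 2 vol01)
    (hc : ∀ s ∈ Ioo (0 : ℝ) 1, ∫ x in Ioo (0 : ℝ) 1, rieszKernel β θ (x - s) * ρ x = c) :
    (1 - β) * ∫ x in Ioo (0 : ℝ) 1, rieszConv β θ φ x * ρ x =
      - ∫ x in Ioo (0 : ℝ) 1, rieszConv β θ (deriv φ) x * (x * ρ x) := by
  have e1 := h.mul_deriv.integral_rieszConv_mul hβ hρ hc
  have e2 := h.integral_rieszConv_mul hβ hρ hc
  rw [h.integral_mul_deriv] at e1
  have hxρ : MemLp (fun x => x * ρ x) 2 vol01 := by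
    obtain ⟨C, -, hC, hm⟩ := exists_bound_of_continuousOn (R := fun x => x) continuousOn_id
    exact MemLp.bdd_mul_vol01 hρ hm hC
  have e3 : ∫ x in Ioo (0 : ℝ) 1, rieszConv β θ (fun s => s * deriv φ s) x * ρ x =
      (∫ x in Ioo (0 : ℝ) 1, rieszConv β θ (deriv φ) x * (x * ρ x)) -
        β * ∫ x in Ioo (0 : ℝ) 1, rieszConv β θ φ x * ρ x := by
    rw [← integral_const_mul, ← integral_sub (h.isTest_deriv.integrableOn_rieszConv_mul hβ θ hxρ)
      ((h.integrableOn_rieszConv_mul hβ θ hρ).const_mul β)]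
    refine setIntegral_congr_fun measurableSet_Ioo fun x hx => ?_
    rw [h.rieszConv_mul_deriv hβ θ hx]
    ring
  linarith

/-! ### Limits in `L²` and `L¹` -/

lemma l2Norm_sub_eq_norm_toLp {w w' : ℝ → ℝ} (h : MemLp w 2 vol01) (h' : MemLp w' 2 vol01) :
    l2Norm (fun x => w x - w' x) = ‖h.toLp w - h'.toLp w'‖ := by
  rw [← MemLp.toLp_sub, Lp.norm_toLp]
  exact l2Norm_eq_eLpNorm (h.sub h')

/-- Completeness of `L²(0,1)` in terms of `l2Norm`. -/
lemma exists_l2_limit {d : ℕ → ℝ → ℝ} (hd : ∀ n, MemLp (d n) 2 vol01)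
    (hc : ∀ ε > 0, ∃ N, ∀ i ≥ N, ∀ j ≥ N, l2Norm (fun x => d i x - d j x) < ε) :
    ∃ g, MemLp g 2 vol01 ∧ Tendsto (fun n => l2Norm (fun x => d n x - g x)) atTop (𝓝 0) := by
  have hcs : CauchySeq fun n => (hd n).toLp (d n) := Metric.cauchySeq_iff.2 fun ε hε => by
    obtain ⟨N, hN⟩ := hc ε hε
    refine ⟨N, fun i hi j hj => ?_⟩
    rw [dist_eq_norm, ← l2Norm_sub_eq_norm_toLp]
    exact hN i hi j hj
  obtain ⟨G, hG⟩ := cauchySeq_tendsto_of_complete hcs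
  refine ⟨G, Lp.memLp G, ?_⟩
  have e : ∀ n, l2Norm (fun x => d n x - G x) = ‖(hd n).toLp (d n) - G‖ := fun n => by
    rw [l2Norm_sub_eq_norm_toLp (hd n) (Lp.memLp G), Lp.toLp_coeFn]
  simp_rw [e]
  exact tendsto_iff_norm_sub_tendsto_zero.1 hG

lemma tendsto_integral_mul_of_l2 {d : ℕ → ℝ → ℝ} {g w : ℝ → ℝ} (hd : ∀ n, MemLp (d n) 2 vol01)
    (hg : MemLp g 2 vol01) (hw : MemLp w 2 vol01)
    (h : Tendsto (fun n => l2Norm (fun x => d n x - g x)) atTop (𝓝 0)) :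
    Tendsto (fun n => ∫ x in Ioo (0 : ℝ) 1, d n x * w x) atTop
      (𝓝 (∫ x in Ioo (0 : ℝ) 1, g x * w x)) := by
  rw [tendsto_iff_norm_sub_tendsto_zero]
  have h1 := h.mul_const (l2Norm w)
  rw [zero_mul] at h1
  refine squeeze_zero (fun _ => norm_nonneg _) (fun n => ?_) h1
  have i1 : IntegrableOn (fun x => d n x * w x) (Ioo 0 1) := (hd n).integrable_mul hw
  have i2 : IntegrableOn (fun x => g x * w x) (Ioo 0 1) := hg.integrable_mul hw
  rw [← integral_sub i1 i2]
  simp_rw [← sub_mul]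
  exact abs_integral_mul_le_l2Norm ((hd n).sub hg) hw

lemma tendsto_integral_mul_of_l1 {y : ℕ → ℝ → ℝ} {v w : ℝ → ℝ} {C : ℝ} {ε : ℕ → ℝ}
    (hy : ∀ n, IntegrableOn (y n) (Ioo 0 1))
    (hv : IntegrableOn v (Ioo 0 1)) (hw : AEStronglyMeasurable w vol01)
    (hC : ∀ᵐ x ∂vol01, |w x| ≤ C)
    (hle : ∀ n, ∫ x in Ioo (0 : ℝ) 1, |y n x - v x| ≤ ε n) (hε : Tendsto ε atTop (𝓝 0)) :
    Tendsto (fun n => ∫ x in Ioo (0 : ℝ) 1, y n x * w x) atTop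
      (𝓝 (∫ x in Ioo (0 : ℝ) 1, v x * w x)) := by
  rw [tendsto_iff_norm_sub_tendsto_zero]
  have h1 := hε.mul_const |C|
  rw [zero_mul] at h1
  refine squeeze_zero (fun _ => norm_nonneg _) (fun n => ?_) h1
  have i1 : IntegrableOn (fun x => y n x * w x) (Ioo 0 1) := (hy n).mul_bdd hw hC
  have i2 : IntegrableOn (fun x => v x * w x) (Ioo 0 1) := hv.mul_bdd hw hC
  rw [← integral_sub i1 i2]
  refine abs_integral_le_integral_abs.trans (le_trans ?_
    (mul_le_mul_of_nonneg_right (hle n) (abs_nonneg C)))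
  rw [← integral_mul_const]
  refine integral_mono_of_nonneg (ae_of_all _ fun x => abs_nonneg _)
    ((((hy n).sub hv).abs).mul_const _) ?_
  filter_upwards [hC] with x hx
  rw [← sub_mul, abs_mul]
  exact mul_le_mul_of_nonneg_left (hx.trans (le_abs_self C)) (abs_nonneg _)

/-! ### From test functions to `H^{1-β}_0(0,1)` -/

lemma IsTest.rieszConv_eq_primitive {β : ℝ} (hβ : 0 < β) (θ : ℝ) {φ : ℝ → ℝ} (h : IsTest φ)
    (x : ℝ) : rieszConv β θ φ x = rieszConv β θ φ 0 + ∫ s in (0 : ℝ)..x,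
      rieszConv β θ (deriv φ) s := by
  rw [intervalIntegral.integral_eq_sub_of_hasDerivAt
    (fun s _ => h.hasDerivAt_rieszConv hβ θ s)
    ((h.isTest_deriv.contDiff_rieszConv hβ θ).continuous.intervalIntegrable _ _)]
  ring

lemma IsTest.hasWeakDeriv_rieszConv {β : ℝ} (hβ : 0 < β) (θ : ℝ) {φ : ℝ → ℝ} (h : IsTest φ) :
    HasWeakDeriv 1 (rieszConv β θ φ) (rieszConv β θ (deriv φ)) := by
  have hd : deriv (rieszConv β θ φ) = rieszConv β θ (deriv φ) :=
    funext fun x => (h.hasDerivAt_rieszConv hβ θ x).deriv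
  rw [← hd]
  exact hasWeakDeriv_of_ac
    (((h.contDiff_rieszConv hβ θ).of_le (by simp)).contDiffOn.absolutelyContinuousOnInterval)

lemma IsTest.memLp_rieszConv {β : ℝ} (hβ : 0 < β) (θ : ℝ) {φ : ℝ → ℝ} (h : IsTest φ) :
    MemLp (rieszConv β θ φ) 2 vol01 :=
  ((h.contDiff_rieszConv hβ θ).continuous.memLp_of_hasCompactSupport
    (h.hasCompactSupport_rieszConv β θ)).restrict _

lemma IsTest.rieszConv_sub {β : ℝ} (hβ : 0 < β) (θ : ℝ) {φ ψ : ℝ → ℝ} (h : IsTest φ)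
    (h' : IsTest ψ) (x : ℝ) :
    rieszConv β θ (fun t => φ t - ψ t) x = rieszConv β θ φ x - rieszConv β θ ψ x := by
  have hc := h.continuous
  have hc' := h'.continuous
  simp_rw [rieszConv, mul_sub]
  exact integral_sub (integrable_rieszKernel_mul_continuous hβ θ (by fun_prop))
    (integrable_rieszKernel_mul_continuous hβ θ (by fun_prop))

/-- The first-order structure of `I^β_θ u` for `u ∈ H^{1-β}_0(0,1)`: it has a weak derivative
`g ∈ L²(0,1)`, and two moments against the weight `ρ` tie `I^β_θ u` to `g`. -/
theorem MemH0.iTheta_structure {β θ c : ℝ} (hβ : 0 < β) (hβ1 : β < 1) {ρ u : ℝ → ℝ}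
    (hρ : MemLp ρ 2 vol01)
    (hc : ∀ s ∈ Ioo (0 : ℝ) 1, ∫ x in Ioo (0 : ℝ) 1, rieszKernel β θ (x - s) * ρ x = c)
    (hu : MemH0 (1 - β) u) :
    ∃ (g : ℝ → ℝ) (a : ℝ), MemLp g 2 vol01 ∧ HasWeakDeriv 1 (iTheta β θ u) g ∧
      iTheta β θ u =ᵐ[vol01] (fun x => a + ∫ s in (0 : ℝ)..x, g s) ∧
      ∫ x in Ioo (0 : ℝ) 1, g x * ρ x = 0 ∧
      (1 - β) * ∫ x in Ioo (0 : ℝ) 1, (a + ∫ s in (0 : ℝ)..x, g s) * ρ x =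
        - ∫ x in Ioo (0 : ℝ) 1, g x * (x * ρ x) := by
  obtain ⟨hu2, φ, hφ, hcau, hlim⟩ := hu
  obtain ⟨C, hC0, hC⟩ := exists_l2Norm_rieszConv_deriv_le hβ hβ1 θ
  have hd : ∀ n, MemLp (rieszConv β θ (deriv (φ n))) 2 vol01 :=
    fun n => (hφ n).isTest_deriv.memLp_rieszConv hβ θ
  obtain ⟨g, hg, hgl⟩ := exists_l2_limit hd (fun ε hε => by
    obtain ⟨N, hN⟩ := hcau (ε / (C + 1)) (by positivity)
    refine ⟨N, fun i hi j hj => ?_⟩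
    have e : (fun x => rieszConv β θ (deriv (φ i)) x - rieszConv β θ (deriv (φ j)) x) =
        rieszConv β θ (deriv fun x => φ i x - φ j x) := by
      have : (deriv fun x => φ i x - φ j x) = fun x => deriv (φ i) x - deriv (φ j) x :=
        funext fun x => deriv_fun_sub ((hφ i).differentiable x) ((hφ j).differentiable x)
      rw [this]
      exact funext fun x =>
        ((hφ i).isTest_deriv.rieszConv_sub hβ θ (hφ j).isTest_deriv x).symm
    rw [e]
    have h1 := hC _ ((hφ i).sub (hφ j))
    have h2 := hN i hi j hj
    have h3 : C * (ε / (C + 1)) < ε := by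
      rw [mul_div_assoc', div_lt_iff₀ (by positivity)]
      nlinarith
    exact (h1.trans (mul_le_mul_of_nonneg_left h2.le hC0)).trans_lt h3)
  have hy1 : ∀ n, IntegrableOn (rieszConv β θ (φ n)) (Ioo 0 1) :=
    fun n => MemLp.integrableOn_Ioo ((hφ n).memLp_rieszConv hβ θ)
  have hIi := (integral_abs_rieszConv_sub_iTheta_le hβ θ hu2 (hφ 0)).1
  have hL1 := fun n => (integral_abs_rieszConv_sub_iTheta_le hβ θ hu2 (hφ n)).2
  have hL1l := hlim.const_mul (∫ t, |rieszKernel β θ t|)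
  rw [mul_zero] at hL1l
  -- Here `ψ'` is bounded, so `L¹` convergence of `I φ_n` to `I u` is enough.
  have hweak : HasWeakDeriv 1 (iTheta β θ u) g := by
    refine ⟨hIi.locallyIntegrableOn, MemLp.locallyIntegrableOn hg, fun ψ hψ => ?_⟩
    rw [iteratedDeriv_one]
    obtain ⟨B, -, hB, hm⟩ := exists_bound_of_continuousOn hψ.isTest_deriv.continuous.continuousOn
    have t1 := tendsto_integral_mul_of_l1 hy1 hIi hm hB hL1 hL1l
    have t2 := (tendsto_integral_mul_of_l2 hd hg
      ((hψ.continuous.memLp_of_hasCompactSupport hψ.2.1).restrict _) hgl).const_mul ((-1) ^ 1)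
    refine tendsto_nhds_unique t1 (t2.congr fun n => ?_)
    have := ((hφ n).hasWeakDeriv_rieszConv hβ θ).2.2 ψ hψ
    rw [iteratedDeriv_one] at this
    exact this.symm
  have hgi := MemLp.integrableOn_Ioo hg
  obtain ⟨a, ha⟩ := hweak.exists_primitive hgi
  have hxρ : MemLp (fun x => x * ρ x) 2 vol01 := by
    obtain ⟨C, -, hC, hm⟩ := exists_bound_of_continuousOn (R := fun x => x) continuousOn_id
    exact MemLp.bdd_mul_vol01 hρ hm hC
  refine ⟨g, a, hg, hweak, ha, ?_, ?_⟩
  · refine tendsto_nhds_unique (tendsto_integral_mul_of_l2 hd hg hρ hgl) ?_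
    simp_rw [(hφ _).integral_rieszConv_deriv_mul hβ hρ hc]
    exact tendsto_const_nhds
  · set Y : ℝ → ℝ := fun x => a + ∫ s in (0 : ℝ)..x, g s with hY
    have hYc : ContinuousOn Y (Icc 0 1) := by
      have := (ac_primitive hgi a).continuousOn
      rwa [uIcc_of_le zero_le_one] at this
    obtain ⟨B, -, hB, hYm⟩ := exists_bound_of_continuousOn hYc
    set δ : ℕ → ℝ := fun n => l2Norm (fun x => rieszConv β θ (deriv (φ n)) x - g x) with hδ
    set ε : ℕ → ℝ := fun n => (∫ t, |rieszKernel β θ t|) * l2Norm (fun x => φ n x - u x) with hε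
    -- The weight is only in `L²`, so the second moment needs more than `L¹` convergence. Two
    -- primitives whose derivatives are `L²`-close differ by a constant up to a uniformly small
    -- error.
    have hdiff : ∀ n, ∀ x ∈ Ioo (0 : ℝ) 1, |rieszConv β θ (φ n) x - Y x -
        (rieszConv β θ (φ n) 0 - a)| ≤ δ n := by
      intro n x hx
      have hdi : ∀ w : ℝ → ℝ, MemLp w 2 vol01 → IntervalIntegrable w volume 0 x := fun w hw =>
        ((intervalIntegrable_iff_integrableOn_Ioo_of_le zero_le_one).2
          (MemLp.integrableOn_Ioo hw)).mono_set (by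
            rw [uIcc_of_le hx.1.le, uIcc_of_le zero_le_one]
            exact Icc_subset_Icc_right hx.2.le)
      have e : rieszConv β θ (φ n) x - Y x - (rieszConv β θ (φ n) 0 - a) =
          ∫ s in (0 : ℝ)..x, (rieszConv β θ (deriv (φ n)) s - g s) := by
        rw [intervalIntegral.integral_sub (hdi _ (hd n)) (hdi _ hg),
          (hφ n).rieszConv_eq_primitive hβ θ x, hY]
        ring
      rw [e]
      exact abs_primitive_le_l2Norm ((hd n).sub hg) hx
    -- The `L¹` convergence makes that constant small too, so `I φ_n` converges to `Y` uniformly on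
    -- `(0,1)`.
    have ha_le : ∀ n, |rieszConv β θ (φ n) 0 - a| ≤ ε n + δ n := by
      intro n
      have i1 : IntegrableOn (fun x => |rieszConv β θ (φ n) x - iTheta β θ u x|) (Ioo 0 1) :=
        ((hy1 n).sub hIi).abs
      have h1 : ∫ x in Ioo (0 : ℝ) 1, |rieszConv β θ (φ n) 0 - a| ≤
          ∫ x in Ioo (0 : ℝ) 1, (|rieszConv β θ (φ n) x - iTheta β θ u x| + δ n) := by
        refine integral_mono_of_nonneg (ae_of_all _ fun x => abs_nonneg _)
          (i1.add (integrable_const _)) ?_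
        filter_upwards [ha, ae_restrict_mem measurableSet_Ioo] with x h1 h2
        have h3 := hdiff n x h2
        rw [h1]
        have h4 := abs_sub_abs_le_abs_sub (rieszConv β θ (φ n) 0 - a)
          (rieszConv β θ (φ n) x - Y x)
        rw [abs_sub_comm (rieszConv β θ (φ n) 0 - a)] at h4
        linarith
      rw [integral_add i1 (integrable_const _)] at h1
      have h2 := hL1 n
      simp only [integral_const, measureReal_restrict_apply_univ, Real.volume_real_Ioo_of_le
        zero_le_one, sub_zero, one_smul] at h1
      linarith
    have hYL : MemLp Y 2 vol01 := memLp_of_bound hYm hB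
    have hlimY : Tendsto (fun n => l2Norm (fun x => rieszConv β θ (φ n) x - Y x)) atTop (𝓝 0) := by
      have hb : Tendsto (fun n => ε n + 2 * δ n) atTop (𝓝 0) := by
        simpa using hL1l.add (hgl.const_mul 2)
      refine squeeze_zero (fun n => l2Norm_nonneg _) (fun n => ?_) hb
      have h4 := ha_le n
      refine l2Norm_le_of_bound ?_ ?_
      · have : 0 ≤ δ n := l2Norm_nonneg _
        linarith [abs_nonneg (rieszConv β θ (φ n) 0 - a)]
      · filter_upwards [ae_restrict_mem measurableSet_Ioo] with x h2
        have h3 := hdiff n x h2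
        have h5 := abs_sub_abs_le_abs_sub (rieszConv β θ (φ n) x - Y x)
          (rieszConv β θ (φ n) 0 - a)
        linarith
    have t1 := (tendsto_integral_mul_of_l2 (fun n => (hφ n).memLp_rieszConv hβ θ) hYL hρ
      hlimY).const_mul (1 - β)
    have t2 := (tendsto_integral_mul_of_l2 hd hg hxρ hgl).neg
    refine tendsto_nhds_unique t1 (t2.congr fun n => ?_)
    exact ((hφ n).integral_rieszConv_euler hβ hρ hc).symm

/-! ### The flux and the a priori bounds -/

lemma IsTest.memH0 {v : ℝ → ℝ} (h : IsTest v) (μ : ℝ) : MemH0 μ v := by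
  refine ⟨(h.continuous.memLp_of_hasCompactSupport h.2.1).restrict _, fun _ => v, fun _ => h,
    fun ε hε => ⟨0, fun i _ j _ => ?_⟩, ?_⟩
  · have : 𝓕 (fun _ : ℝ => (0 : ℂ)) = 0 := by
      ext ξ
      simp [Real.fourier_eq]
    simpa [fracNorm, this] using hε
  · simp [l2Norm]

lemma IsTest.weakDeriv_ae_eq {v : ℝ → ℝ} (h : IsTest v) : weakDeriv 1 v =ᵐ[vol01] deriv v :=
  FracDiff.weakDeriv_ae_eq (hasWeakDeriv_of_ac
    ((h.1.of_le (by simp)).contDiffOn.absolutelyContinuousOnInterval))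

/-- For a weak solution the flux `K D I^β_θ u` has weak derivative `-f`. -/
lemma IsWeakSolution.hasWeakDeriv_flux {β θ : ℝ} {K f u g : ℝ → ℝ}
    (h : IsWeakSolution β θ K f u) (hK : ContinuousOn K (Icc 0 1)) (hf : MemLp f 2 vol01)
    (hg : MemLp g 2 vol01) (hug : HasWeakDeriv 1 (iTheta β θ u) g) :
    HasWeakDeriv 1 (fun x => K x * g x) (fun x => - f x) := by
  obtain ⟨B, -, hB, hm⟩ := exists_bound_of_continuousOn hK
  refine ⟨MemLp.locallyIntegrableOn (MemLp.bdd_mul_vol01 hg hm hB),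
    MemLp.locallyIntegrableOn hf.neg, fun φ hφ => ?_⟩
  have e := h.2 φ (hφ.memH0 1)
  have e1 : ∫ x in Ioo (0 : ℝ) 1, K x * weakDeriv 1 (iTheta β θ u) x * weakDeriv 1 φ x =
      ∫ x in Ioo (0 : ℝ) 1, K x * g x * deriv φ x := integral_congr_ae (by
    filter_upwards [hφ.weakDeriv_ae_eq, weakDeriv_ae_eq hug] with x h1 h2
    rw [h1, h2])
  rw [iteratedDeriv_one, ← e1, e]
  simp [integral_neg]

/-- A priori bounds: the flux, the derivative and the value of `I^β_θ u` are all
controlled by `‖f‖_{L²}`, because the vanishing moment of `D I^β_θ u` against the weight determines the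
constant of integration of the flux. -/
lemma IsWeakSolution.exists_apriori {β θ : ℝ} (hβ : 0 < β) (hβ' : β < 1 / 2) (hθ : 0 ≤ θ)
    (hθ' : θ ≤ 1) {K : ℝ → ℝ} {Km KM : ℝ} (hKm : 0 < Km)
    (hK : ∀ x ∈ Ioo (0 : ℝ) 1, Km ≤ K x ∧ K x ≤ KM) (hKc : ContinuousOn K (Icc 0 1))
    {f u : ℝ → ℝ} (hf : MemLp f 2 vol01) (h : IsWeakSolution β θ K f u) :
    ∃ g, HasWeakDeriv 1 (iTheta β θ u) g ∧
      HasWeakDeriv 1 (fun x => K x * g x) (fun x => - f x) ∧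
      MemLp (fun x => K x * g x) 2 vol01 ∧ l2Norm (fun x => K x * g x) ≤ 2 * l2Norm f ∧
      MemLp (iTheta β θ u) 2 vol01 ∧
      l2Norm (iTheta β θ u) ≤ (2 / Km + 4 / Km / (1 - β)) * l2Norm f := by
  obtain ⟨ρ, hρ, hρ0, c, hc⟩ := exists_weight hβ hβ' hθ hθ'
  obtain ⟨g, a, hg, hug, hua, hm1, hm2⟩ := h.1.iTheta_structure hβ (by linarith) hρ hc
  have hflux := h.hasWeakDeriv_flux hKc hf hg hug
  obtain ⟨B, -, hB, hKmeas⟩ := exists_bound_of_continuousOn hKc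
  have hKg := MemLp.bdd_mul_vol01 hg hKmeas hB
  set N := l2Norm f with hN
  have hN0 : 0 ≤ N := l2Norm_nonneg f
  obtain ⟨b, hb⟩ := hflux.exists_primitive (MemLp.integrableOn_Ioo hf.neg)
  have hρi := MemLp.integrableOn_Ioo hρ
  have hF : ∀ x ∈ Ioo (0 : ℝ) 1, |∫ s in (0 : ℝ)..x, - f s| ≤ N := fun x hx => by
    rw [intervalIntegral.integral_neg, abs_neg]
    exact abs_primitive_le_l2Norm hf hx
  have hinv : AEStronglyMeasurable (fun x => (K x)⁻¹) vol01 := by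
    have : ContinuousOn (fun x => (K x)⁻¹) (Ioo 0 1) :=
      (hKc.mono Ioo_subset_Icc_self).inv₀ fun x hx => (hKm.trans_le (hK x hx).1).ne'
    exact this.aestronglyMeasurable measurableSet_Ioo
  have hinvb : ∀ᵐ x ∂vol01, |(K x)⁻¹| ≤ Km⁻¹ := by
    filter_upwards [ae_restrict_mem measurableSet_Ioo] with x hx
    have h1 := hKm.trans_le (hK x hx).1
    rw [abs_of_pos (inv_pos.2 h1)]
    exact inv_anti₀ hKm (hK x hx).1
  have hρK : IntegrableOn (fun x => (K x)⁻¹ * ρ x) (Ioo 0 1) :=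
    MemLp.integrableOn_Ioo (MemLp.bdd_mul_vol01 hρ hinv hinvb)
  have hpos : ∀ w : ℝ → ℝ, IntegrableOn w (Ioo 0 1) → (∀ x ∈ Ioo (0 : ℝ) 1, 0 < w x) →
      0 < ∫ x in Ioo (0 : ℝ) 1, w x := fun w hw hw0 => by
    rw [setIntegral_pos_iff_support_of_nonneg_ae _ hw]
    · have : Ioo (0 : ℝ) 1 ⊆ Function.support w ∩ Ioo 0 1 :=
        fun x hx => ⟨(hw0 x hx).ne', hx⟩
      refine lt_of_lt_of_le ?_ (measure_mono this)
      simp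
    · filter_upwards [ae_restrict_mem measurableSet_Ioo] with x hx
      exact (hw0 x hx).le
  have hρKpos : 0 < ∫ x in Ioo (0 : ℝ) 1, (K x)⁻¹ * ρ x := hpos _ hρK fun x hx =>
    mul_pos (inv_pos.2 (hKm.trans_le (hK x hx).1)) (hρ0 x hx)
  have hρpos : 0 < ∫ x in Ioo (0 : ℝ) 1, ρ x := hpos _ hρi hρ0
  have hae : ∀ᵐ x ∂vol01, g x = (b + ∫ s in (0 : ℝ)..x, - f s) * (K x)⁻¹ := by
    filter_upwards [hb, ae_restrict_mem measurableSet_Ioo] with x h1 h2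
    rw [← h1]
    field_simp [(hKm.trans_le (hK x h2).1).ne']
  have hgρ : IntegrableOn (fun x => g x * ρ x) (Ioo 0 1) := hg.integrable_mul hρ
  -- Dividing the flux by `K` and using `∫ g ρ = 0` exhibits `b` as minus the average of `∫₀ˣ (-f)`
  -- for the positive weight `ρ / K`.
  have hbN : |b| ≤ N := by
    have e : b * ∫ x in Ioo (0 : ℝ) 1, (K x)⁻¹ * ρ x =
        - ∫ x in Ioo (0 : ℝ) 1, (g x * ρ x - b * ((K x)⁻¹ * ρ x)) := by
      rw [integral_sub hgρ (hρK.const_mul b), hm1, integral_const_mul]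
      ring
    have h1 : |b| * ∫ x in Ioo (0 : ℝ) 1, (K x)⁻¹ * ρ x ≤
        N * ∫ x in Ioo (0 : ℝ) 1, (K x)⁻¹ * ρ x := by
      rw [← abs_of_pos hρKpos, ← abs_mul, e, abs_neg, abs_of_pos hρKpos, ← integral_const_mul]
      refine abs_integral_le_integral_abs.trans (integral_mono_of_nonneg
        (ae_of_all _ fun x => abs_nonneg _) (hρK.const_mul N) ?_)
      filter_upwards [hae, ae_restrict_mem measurableSet_Ioo] with x h1 h2
      have h3 : 0 < (K x)⁻¹ * ρ x :=
        mul_pos (inv_pos.2 (hKm.trans_le (hK x h2).1)) (hρ0 x h2)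
      rw [h1, show (b + ∫ s in (0 : ℝ)..x, - f s) * (K x)⁻¹ * ρ x - b * ((K x)⁻¹ * ρ x) =
        (∫ s in (0 : ℝ)..x, - f s) * ((K x)⁻¹ * ρ x) by ring, abs_mul,
        abs_of_pos h3]
      exact mul_le_mul_of_nonneg_right (hF x h2) h3.le
    exact le_of_mul_le_mul_right h1 hρKpos
  have hflux_le : ∀ᵐ x ∂vol01, |K x * g x| ≤ 2 * N := by
    filter_upwards [hb, ae_restrict_mem measurableSet_Ioo] with x h1 h2
    rw [h1]
    linarith [abs_add_le b (∫ s in (0 : ℝ)..x, - f s), hF x h2]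
  have hg_le : ∀ᵐ x ∂vol01, |g x| ≤ 2 * N / Km := by
    filter_upwards [hflux_le, ae_restrict_mem measurableSet_Ioo] with x h1 h2
    have h3 := (hK x h2).1
    rw [abs_mul, abs_of_pos (hKm.trans_le h3)] at h1
    rw [le_div_iff₀ hKm]
    nlinarith [abs_nonneg (g x)]
  set G := 2 * N / Km with hG
  have hG0 : 0 ≤ G := by positivity
  have hprim : ∀ x ∈ Ioo (0 : ℝ) 1, |∫ s in (0 : ℝ)..x, g s| ≤ G := fun x hx =>
    (abs_primitive_le_l2Norm hg hx).trans (l2Norm_le_of_bound hG0 hg_le)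
  have hβ1 : 0 < 1 - β := by linarith
  -- The second moment, divided by `∫ ρ > 0`, bounds `a`: the average of `∫₀ˣ g` costs `G`, and the
  -- average of `x g` costs `G / (1-β)`.
  have ha_le : |a| ≤ G + G / (1 - β) := by
    have i1 : IntegrableOn (fun x => (∫ s in (0 : ℝ)..x, g s) * ρ x) (Ioo 0 1) := by
      have hc := (ac_primitive (MemLp.integrableOn_Ioo hg) 0).continuousOn
      rw [uIcc_of_le zero_le_one] at hc
      obtain ⟨B, -, hB, hm⟩ := exists_bound_of_continuousOn hc
      simpa using MemLp.integrableOn_Ioo (MemLp.bdd_mul_vol01 hρ hm hB)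
    have e : a * ∫ x in Ioo (0 : ℝ) 1, ρ x =
        - (∫ x in Ioo (0 : ℝ) 1, (∫ s in (0 : ℝ)..x, g s) * ρ x) -
          (∫ x in Ioo (0 : ℝ) 1, g x * (x * ρ x)) / (1 - β) := by
      have e1 : ∫ x in Ioo (0 : ℝ) 1, (a + ∫ s in (0 : ℝ)..x, g s) * ρ x =
          a * (∫ x in Ioo (0 : ℝ) 1, ρ x) +
            ∫ x in Ioo (0 : ℝ) 1, (∫ s in (0 : ℝ)..x, g s) * ρ x := by
        rw [← integral_const_mul, ← integral_add (hρi.const_mul a) i1]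
        simp_rw [add_mul]
      rw [e1] at hm2
      have e2 : (∫ x in Ioo (0 : ℝ) 1, g x * (x * ρ x)) / (1 - β) =
          -(a * (∫ x in Ioo (0 : ℝ) 1, ρ x) +
            ∫ x in Ioo (0 : ℝ) 1, (∫ s in (0 : ℝ)..x, g s) * ρ x) := by
        rw [div_eq_iff hβ1.ne']
        linarith
      rw [e2]
      ring
    have b1 : |∫ x in Ioo (0 : ℝ) 1, (∫ s in (0 : ℝ)..x, g s) * ρ x| ≤
        G * ∫ x in Ioo (0 : ℝ) 1, ρ x := by
      rw [← integral_const_mul]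
      refine abs_integral_le_integral_abs.trans (integral_mono_of_nonneg
        (ae_of_all _ fun x => abs_nonneg _) (hρi.const_mul G) ?_)
      filter_upwards [ae_restrict_mem measurableSet_Ioo] with x h2
      rw [abs_mul, abs_of_pos (hρ0 x h2)]
      exact mul_le_mul_of_nonneg_right (hprim x h2) (hρ0 x h2).le
    have b2 : |∫ x in Ioo (0 : ℝ) 1, g x * (x * ρ x)| ≤ G * ∫ x in Ioo (0 : ℝ) 1, ρ x := by
      rw [← integral_const_mul]
      refine abs_integral_le_integral_abs.trans (integral_mono_of_nonneg
        (ae_of_all _ fun x => abs_nonneg _) (hρi.const_mul G) ?_)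
      filter_upwards [hg_le, ae_restrict_mem measurableSet_Ioo] with x h1 h2
      have h3 := hρ0 x h2
      rw [abs_mul, abs_mul, abs_of_pos h3, abs_of_pos h2.1]
      exact mul_le_mul h1 (by nlinarith [h2.2]) (mul_pos h2.1 h3).le hG0
    have h1 : |a| * (∫ x in Ioo (0 : ℝ) 1, ρ x) ≤
        (G + G / (1 - β)) * ∫ x in Ioo (0 : ℝ) 1, ρ x := by
      rw [← abs_of_pos hρpos, ← abs_mul, e, abs_of_pos hρpos]
      refine (abs_sub _ _).trans ?_
      rw [abs_neg, abs_div, abs_of_pos hβ1, add_mul, div_mul_eq_mul_div G (1 - β)]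
      exact add_le_add b1 (div_le_div_of_nonneg_right b2 hβ1.le)
    exact le_of_mul_le_mul_right h1 hρpos
  have hy_le : ∀ᵐ x ∂vol01, |iTheta β θ u x| ≤ (2 / Km + 4 / Km / (1 - β)) * N := by
    filter_upwards [hua, ae_restrict_mem measurableSet_Ioo] with x h1 h2
    rw [h1]
    -- The bound `2 G + G / (1-β)` is rounded up to `G + 2 G / (1-β)`.
    have h3 : G ≤ G / (1 - β) := le_div_self hG0 hβ1 (by linarith)
    have h4 : (2 / Km + 4 / Km / (1 - β)) * N = G + 2 * (G / (1 - β)) := by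
      rw [hG]; ring
    rw [h4]
    linarith [abs_add_le a (∫ s in (0 : ℝ)..x, g s), hprim x h2]
  have hymeas : AEStronglyMeasurable (iTheta β θ u) vol01 := by
    have hc := (ac_primitive (MemLp.integrableOn_Ioo hg) a).continuousOn
    rw [uIcc_of_le zero_le_one] at hc
    obtain ⟨B, -, -, hm⟩ := exists_bound_of_continuousOn hc
    exact hm.congr hua.symm
  exact ⟨g, hug, hflux, hKg, l2Norm_le_of_bound (by positivity) hflux_le,
    memLp_of_bound hymeas hy_le, l2Norm_le_of_bound (by positivity) hy_le⟩

end FracDiff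

/-! ### The bootstrap -/

theorem theorem6p5 (β θ : ℝ) (hβ : 0 < β) (hβ' : β < 1 / 2) (hθ : 0 ≤ θ) (hθ' : θ ≤ 1)
    (m : ℕ) (K : ℝ → ℝ) (Km KM : ℝ) (hKm : 0 < Km)
    (hK : ∀ x ∈ Set.Ioo (0 : ℝ) 1, Km ≤ K x ∧ K x ≤ KM)
    (hKreg : ContDiffOn ℝ ((m + 1 : ℕ) : WithTop ℕ∞) K (Set.Icc 0 1))
    (hcond : SolvCond β θ K) :
    ∃ C : ℝ, 0 < C ∧ ∀ f u : ℝ → ℝ, MemH m f → IsWeakSolution β θ K f u →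
      (MemH (m + 2) (iTheta β θ u) ∧
        hNorm (m + 2) (iTheta β θ u) ≤ C * (cNorm (m + 1) K + hNorm m f)) ∧
      (HasWeakDeriv (m + 2) (iTheta β θ u) (weakDeriv (m + 2) (iTheta β θ u)) ∧
        MemLp (weakDeriv (m + 2) (iTheta β θ u)) 2 vol01 ∧
        l2Norm (weakDeriv (m + 2) (iTheta β θ u)) ≤ C * (cNorm (m + 1) K + hNorm m f)) := by
  -- The lower bound extends by continuity to the endpoints, so that `1/K` is `C^{m+1}` on the
  -- closed interval.
  have hKpos : ∀ x ∈ Set.Icc (0 : ℝ) 1, Km ≤ K x := by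
    have hcl : closure (Set.Ioo (0 : ℝ) 1) = Set.Icc 0 1 := closure_Ioo zero_ne_one
    intro x hx
    rw [← hcl] at hx
    exact ContinuousWithinAt.closure_le hx continuousWithinAt_const
      ((hKreg.continuousOn x (hcl ▸ hx)).mono Set.Ioo_subset_Icc_self) fun y hy => (hK y hy).1
  have hR : ContDiffOn ℝ ((m + 1 : ℕ) : WithTop ℕ∞) (fun x => (K x)⁻¹) (Set.Icc 0 1) :=
    hKreg.inv fun x hx => (hKm.trans_le (hKpos x hx)).ne'
  obtain ⟨C1, hC1, hmul⟩ := SobolevBound.exists_mul (m + 1) _ hR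
  set C2 := 2 / Km + 4 / Km / (1 - β) with hC2
  have hC20 : 0 < C2 := by
    have : 0 < 1 - β := by linarith
    positivity
  -- `C2` bounds the function itself; `C1 * 2` bounds its derivative, as the flux costs `2 N` and
  -- division by `K` costs `C1`.
  set C3 := C2 + C1 * 2 with hC3
  have hC30 : 0 < C3 := by positivity
  -- The extra factor `m + 3` is the number of derivatives summed in the `H^{m+2}` norm.
  refine ⟨(((m + 2 : ℕ) : ℝ) + 1) * C3, by positivity, fun f u hf hu => ?_⟩
  have hfb := hf.sobolevBound
  set N := hNorm m f with hN
  have hN0 : 0 ≤ N := hfb.nonneg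
  obtain ⟨g, hug, hflux, hZ, hZle, hy, hyle⟩ :=
    hu.exists_apriori hβ hβ' hθ hθ' hKm hK hKreg.continuousOn hfb.base.1
  have hfN := hfb.base.2
  -- The flux gains one order over `f`, its weak derivative being `-f`.
  have hZb : SobolevBound (m + 1) (fun x => K x * g x) (2 * N) :=
    ⟨⟨hZ, by linarith⟩, _, hflux, hfb.neg.mono (by linarith)⟩
  have hgb : SobolevBound (m + 1) g (C1 * (2 * N)) := by
    refine (hmul _ _ hZb).congr ?_
    filter_upwards [ae_restrict_mem measurableSet_Ioo] with x hx
    rw [inv_mul_cancel_left₀ (hKm.trans_le (hK x hx).1).ne']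
  have hyb : SobolevBound (m + 2) (iTheta β θ u) (C3 * N) := by
    refine ⟨⟨hy, hyle.trans ?_⟩, g, hug, hgb.mono ?_⟩
    · rw [hC3]
      nlinarith [mul_le_mul_of_nonneg_left hfN hC20.le, mul_nonneg hC1 hN0]
    · rw [hC3]
      nlinarith
  have hcN := cNorm_nonneg (m + 1) K
  have hle : C3 * N ≤ (((m + 2 : ℕ) : ℝ) + 1) * (C3 * N) :=
    le_mul_of_one_le_left (by positivity) (by simp; positivity)
  have hfin : (((m + 2 : ℕ) : ℝ) + 1) * (C3 * N) ≤
      (((m + 2 : ℕ) : ℝ) + 1) * C3 * (cNorm (m + 1) K + N) := by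
    rw [← mul_assoc]
    exact mul_le_mul_of_nonneg_left (by linarith) (by positivity)
  obtain ⟨w1, w2, w3⟩ := hyb.weakDeriv_spec le_rfl
  exact ⟨⟨hyb.memH, hyb.hNorm_le.trans hfin⟩, w1, w2, w3.trans (hle.trans hfin)⟩
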